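/- Let $M$ be a complex manifold of dimension $n\ge 1$, and let $\pi:\widetilde M\to M$ be the $(2n-1)$-dimensional complex manifold of contact elements of $M$ (pairs of a point $m\in M$ and a hyperplane of $T_mM$). Let $\mathcal T\subset\pi^{-1}(TM)$ be the tautological bundle, $\mathcal L=\pi^{-1}(TM)/\mathcal T$, and $\omega:T\widetilde M\to\mathcal L$ the tautological contact form, obtained by composing $d\pi$ with the projection to $\mathcal L$. Holomorphic coordinates $x=(x_1,\dots,x_n)$ on an open set of $M$ give coordinates $(x,p)=(x_1,\dots,x_n,p_1,\dots,p_{n-1})$ on the contact elements over that set which do not contain $\partial/\partial x_n$: the hyperplane with coordinates $(x,p)$ is the kernel of $\eta=dx_n-\sum_{\alpha=1}^{n-1} p_\alpha\,dx_\alpha$. For a closed analytic subset $W\subset\widetilde M$ of pure dimension $n$, let $W'$ be its regular part, $\Gamma_W$ the set of points of $W$ at which $W$ is singular or the differential of $\pi|_{W'}$ is not an isomorphism, $W_0=W\setminus\Gamma_W$, and $M_0=M\setminus\pi(\Gamma_W)$, the complement of the caustic $\pi(\Gamma_W)$. $W$ is a $d$-web on $M$ ($d\ge 1$) if $\pi(W)=M$;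 the restriction of $\omega$ to $W'$ is integrable ($\eta\wedge d\eta=0$ on $W'$ in all coordinates $(x,p)$); $W$ is a $d$-fold covering over $M_0$; $\Gamma_W$ is empty or of dimension at most $n-1$; and each fibre $W\cap\pi^{-1}(m)$ is finite and of degree $d$, points being counted with multiplicity. A leaf of the web is a complex hypersurface (possibly small) of $M$ whose tangent hyperplanes belong to $W_0$; there is locally exactly one leaf tangent to each element of $W_0$. The web is totally linearizable if near every point of $M$, including the points of the caustic, there are holomorphic coordinates in which the leaves of the web have affine equations. Let $C$ be an irreducible component of $W$, with regular part $C'$. The holomorphic vector fields on $C'$ that lie in the kernel of $\omega|_{C'}$ define a foliation of codimension one on $C'$, possibly with singularities. The web is dicritical on $C$ if this foliation is non-singular, that is, if near each point of $C'$ there are $n-1$ such vector fields that are linearly independent at this point. The web is dicritical if it is dicritical on each irreducible component. **Proposition.** Let $W$ be a totally linearizable $d$-web on $M$. Then $W$ is dicritical. Moreover, for each irreducible component $C$ of $W$, the natural injection $\mathcal T|_{W_0}\to TW_0$ (the inverse of $d\pi$) extends over $C'$ to an injective holomorphic morphism $\mathcal T|_{C'}\to TC'$. Finally, in all coordinates $(x,p)$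 attached to holomorphic coordinates $x$ in which the leaves of the web have affine equations, every local holomorphic function $F(x,p)$ that vanishes on $W$ satisfies $$\Theta_\alpha:=\frac{\partial F}{\partial x_\alpha}+p_\alpha\frac{\partial F}{\partial x_n}=0\quad\text{on } W\qquad(1\le\alpha\le n-1).$$ In particular, the matrix $\Theta$ formed with local equations $F_1,\dots,F_{n-1}$ of $W$ vanishes on $W$ when $W$ is a local complete intersection. -/

import Mathlib

open Set Filter Topology
open scoped Manifold ContDiff

noncomputable section

/-- The model space `ℂⁿ`. -/
abbrev Cn (n : ℕ) := EuclideanSpace ℂ (Fin n)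

/-- The `i`-th vector of the canonical basis of `ℂⁿ`. -/
def basisVec {n : ℕ} (i : Fin n) : Cn n := EuclideanSpace.single i (1 : ℂ)

/-- The linear form `η_p = dx_n - ∑_α p_α dx_α` on `ℂⁿ`, `n = N + 1`. -/
def eta {N : ℕ} (p : Cn N) : Cn (N + 1) →L[ℂ] ℂ :=
  EuclideanSpace.proj (Fin.last N) - ∑ α : Fin N, p α • EuclideanSpace.proj α.castSucc

/-- The hyperplane of `ℂⁿ` with slopes `p`, the kernel of `η_p`. -/
def graphPlane {N : ℕ} (p : Cn N) : Submodule ℂ (Cn (N + 1)) :=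
  LinearMap.ker (eta p : Cn (N + 1) →ₗ[ℂ] ℂ)

/-- The slopes `p` of a hyperplane of `ℂⁿ` that does not contain `∂/∂x_n`: the numbers such that
`∂/∂x_α + p_α ∂/∂x_n` belongs to it (arbitrary values for other subspaces). -/
def planeSlope {N : ℕ} (Q : Submodule ℂ (Cn (N + 1))) : Cn N :=
  WithLp.toLp 2 fun α : Fin N =>
    Classical.epsilon fun c : ℂ => basisVec α.castSucc + c • basisVec (Fin.last N) ∈ Q

theorem eta_apply {N : ℕ} (p : Cn N) (v : Cn (N + 1)) :
    eta p v = v (Fin.last N) - ∑ α : Fin N, p α * v α.castSucc := by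
  simp [eta]

theorem mem_graphPlane {N : ℕ} {p : Cn N} {v : Cn (N + 1)} :
    v ∈ graphPlane p ↔ eta p v = 0 := Iff.rfl

theorem eta_last {N : ℕ} (p : Cn N) : eta p (basisVec (Fin.last N)) = 1 := by
  simp [eta_apply, basisVec, Fin.castSucc_ne_last]

theorem eta_castSucc {N : ℕ} (p : Cn N) (β : Fin N) :
    eta p (basisVec β.castSucc) = - p β := by
  simp [eta_apply, basisVec, (Fin.castSucc_ne_last _).symm]

theorem finrank_graphPlane {N : ℕ} (p : Cn N) : Module.finrank ℂ (graphPlane p) = N := by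
  have h := LinearMap.finrank_range_add_finrank_ker (eta p : Cn (N + 1) →ₗ[ℂ] ℂ)
  have hs : Function.Surjective (eta p : Cn (N + 1) →ₗ[ℂ] ℂ) := by
    intro c
    exact ⟨c • basisVec (Fin.last N), by simp [eta_last]⟩
  rw [LinearMap.range_eq_top.2 hs] at h
  simp at h
  have : Module.finrank ℂ (graphPlane p) = Module.finrank ℂ (LinearMap.ker (eta p : Cn (N + 1) →ₗ[ℂ] ℂ)) := rfl
  omega

/-- Slopes of a hyperplane given as the zero set of a linear form. -/
theorem planeSlope_apply_of_mem_iff {N : ℕ} {Q : Submodule ℂ (Cn (N + 1))} (u : Cn (N + 1) →L[ℂ] ℂ)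
    (hQ : ∀ v, v ∈ Q ↔ u v = 0) (hu : u (basisVec (Fin.last N)) ≠ 0) (α : Fin N) :
    planeSlope Q α = - u (basisVec α.castSucc) / u (basisVec (Fin.last N)) := by
  have key : ∀ c : ℂ, basisVec α.castSucc + c • basisVec (Fin.last N) ∈ Q ↔
      c = - u (basisVec α.castSucc) / u (basisVec (Fin.last N)) := by
    intro c
    rw [hQ, map_add, map_smul, smul_eq_mul, eq_div_iff hu]
    constructor <;> intro h <;> linear_combination h
  have h := Classical.epsilon_spec
    (p := fun c : ℂ => basisVec α.castSucc + c • basisVec (Fin.last N) ∈ Q)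
    ⟨_, (key _).2 rfl⟩
  exact (key _).1 h

theorem planeSlope_graphPlane {N : ℕ} (p : Cn N) : planeSlope (graphPlane p) = p := by
  ext α
  rw [planeSlope_apply_of_mem_iff (eta p) (fun v => Iff.rfl) (by simp [eta_last])]
  simp [eta_last, eta_castSucc]

theorem graphPlane_planeSlope {N : ℕ} {Q : Submodule ℂ (Cn (N + 1))}
    (hQ : Module.finrank ℂ Q = N) (hn : basisVec (Fin.last N) ∉ Q) :
    graphPlane (planeSlope Q) = Q := by
  obtain ⟨u, hu, hQu⟩ := Submodule.exists_le_ker_of_notMem (K := ℂ) hn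
  have hne : LinearMap.range u = ⊤ := by
    refine LinearMap.range_eq_top.2 fun c => ⟨(c / u (basisVec (Fin.last N))) • basisVec (Fin.last N), ?_⟩
    simp [hu]
  have hk := LinearMap.finrank_range_add_finrank_ker u
  rw [hne] at hk
  simp at hk
  have hker : Q = LinearMap.ker u := Submodule.eq_of_le_of_finrank_eq hQu (by omega)
  have hs : ∀ α, planeSlope Q α = - u (basisVec α.castSucc) / u (basisVec (Fin.last N)) :=
    planeSlope_apply_of_mem_iff (LinearMap.toContinuousLinearMap u) (fun v => by rw [hker]; rfl) hu
  have hle : Q ≤ graphPlane (planeSlope Q) := by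
    intro v hv
    rw [hker, LinearMap.mem_ker] at hv
    have hdec : v = ∑ i, v i • basisVec i := by
      ext j
      simp [basisVec, Pi.single_apply]
    rw [hdec, map_sum, Fin.sum_univ_castSucc] at hv
    simp only [map_smul, smul_eq_mul] at hv
    rw [mem_graphPlane, eta_apply]
    have : (∑ α : Fin N, planeSlope Q α * v α.castSucc) =
        - (∑ α : Fin N, v α.castSucc * u (basisVec α.castSucc)) / u (basisVec (Fin.last N)) := by
      rw [← Finset.sum_neg_distrib, Finset.sum_div]
      refine Finset.sum_congr rfl fun α _ => ?_
      rw [hs]; ring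
    rw [this]
    have h2 : u (basisVec (Fin.last N)) ≠ 0 := hu
    field_simp
    linear_combination hv
  exact (Submodule.eq_of_le_of_finrank_eq hle (by rw [finrank_graphPlane, hQ])).symm

section ContactElements

variable (N : ℕ) (M : Type*) [TopologicalSpace M] [ChartedSpace (Cn (N + 1)) M]

/-- A contact element of the `n`-dimensional complex manifold `M` (`n = N + 1`): a point `m` of `M`
and an `(n - 1)`-dimensional linear subspace of `T_m M`. -/
structure ContactElement where
  /-- the projection of the contact element on `M` -/
  base : M
  /-- the hyperplane of the tangent space -/
  plane : Submodule ℂ (TangentSpace 𝓘(ℂ, Cn (N + 1)) base)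
  finrank_plane : Module.finrank ℂ plane = N

/-- The holomorphic coordinate systems on open subsets of `M`. -/
abbrev HolCoord (M : Type*) {n : ℕ} [TopologicalSpace M] [ChartedSpace (Cn n) M] :
    Set (OpenPartialHomeomorph M (Cn n)) :=
  IsManifold.maximalAtlas 𝓘(ℂ, Cn n) ω M

variable {N M}

/-- The differential at `m` of a coordinate system. -/
def coordDeriv (e : OpenPartialHomeomorph M (Cn (N + 1))) (m : M) :
    TangentSpace 𝓘(ℂ, Cn (N + 1)) m →L[ℂ] Cn (N + 1) :=
  mfderiv 𝓘(ℂ, Cn (N + 1)) 𝓘(ℂ, Cn (N + 1)) e m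

/-- The differential at `x` of the inverse of a coordinate system. -/
def coordSymmDeriv (e : OpenPartialHomeomorph M (Cn (N + 1))) (x : Cn (N + 1)) :
    Cn (N + 1) →L[ℂ] Cn (N + 1) :=
  mfderiv 𝓘(ℂ, Cn (N + 1)) 𝓘(ℂ, Cn (N + 1)) e.symm x

namespace ContactElement

/-- The hyperplane of `ℂⁿ` that a contact element becomes in the coordinates `e`. -/
def planeIn (e : OpenPartialHomeomorph M (Cn (N + 1))) (w : ContactElement N M) :
    Submodule ℂ (Cn (N + 1)) :=
  w.plane.map (coordDeriv e w.base : _ →ₗ[ℂ] Cn (N + 1))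

/-- The contact element at `m` with a given hyperplane. -/
def ofPlane (m : M) (Q : Submodule ℂ (Cn (N + 1))) (h : Module.finrank ℂ Q = N) :
    ContactElement N M :=
  ⟨m, Q, h⟩

theorem ofPlane_congr {m m' : M} (hm : m = m') {Q Q' : Submodule ℂ (Cn (N + 1))} (hQ : Q = Q')
    (h : Module.finrank ℂ Q = N) (h' : Module.finrank ℂ Q' = N) :
    ofPlane m Q h = ofPlane m' Q' h' := by
  cases hm; cases hQ; rfl

open Classical in
/-- The contact element with coordinates `(x, p)` (arbitrary if `x` is not in the range of the
coordinates). -/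
def ofCoord (e : OpenPartialHomeomorph M (Cn (N + 1))) (q : Cn (N + 1) × Cn N) :
    ContactElement N M :=
  if h : Module.finrank ℂ
      ((graphPlane q.2).map (coordSymmDeriv e q.1 : Cn (N + 1) →ₗ[ℂ] Cn (N + 1))) = N then
    ofPlane (e.symm q.1)
      ((graphPlane q.2).map (coordSymmDeriv e q.1 : Cn (N + 1) →ₗ[ℂ] Cn (N + 1))) h
  else ofPlane (e.symm q.1) (graphPlane q.2) (finrank_graphPlane q.2)

theorem mdifferentiable_holCoord {e : OpenPartialHomeomorph M (Cn (N + 1))} (he : e ∈ HolCoord M) :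
    e.MDifferentiable 𝓘(ℂ, Cn (N + 1)) 𝓘(ℂ, Cn (N + 1)) :=
  ⟨(contMDiffOn_of_mem_maximalAtlas he).mdifferentiableOn (by simp),
    (contMDiffOn_symm_of_mem_maximalAtlas he).mdifferentiableOn (by simp)⟩

theorem coordSymmDeriv_coordDeriv {e : OpenPartialHomeomorph M (Cn (N + 1))} (he : e ∈ HolCoord M)
    {m : M} (hm : m ∈ e.source) (v : TangentSpace 𝓘(ℂ, Cn (N + 1)) m) :
    (coordSymmDeriv e (e m) (coordDeriv e m v) : Cn (N + 1)) = v :=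
  DFunLike.congr_fun ((mdifferentiable_holCoord he).symm_comp_deriv hm) v

theorem coordDeriv_coordSymmDeriv {e : OpenPartialHomeomorph M (Cn (N + 1))} (he : e ∈ HolCoord M)
    {x : Cn (N + 1)} (hx : x ∈ e.target) (v : Cn (N + 1)) :
    coordDeriv e (e.symm x) (coordSymmDeriv e x v) = v :=
  DFunLike.congr_fun ((mdifferentiable_holCoord he).comp_symm_deriv hx) v

theorem coordDeriv_injective {e : OpenPartialHomeomorph M (Cn (N + 1))} (he : e ∈ HolCoord M)
    {m : M} (hm : m ∈ e.source) : Function.Injective (coordDeriv e m) :=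
  (mdifferentiable_holCoord he).mfderiv_injective hm

theorem coordSymmDeriv_injective {e : OpenPartialHomeomorph M (Cn (N + 1))} (he : e ∈ HolCoord M)
    {x : Cn (N + 1)} (hx : x ∈ e.target) : Function.Injective (coordSymmDeriv e x) :=
  (mdifferentiable_holCoord he).symm.mfderiv_injective hx

theorem finrank_planeIn {e : OpenPartialHomeomorph M (Cn (N + 1))} (he : e ∈ HolCoord M)
    {w : ContactElement N M} (hw : w.base ∈ e.source) :
    Module.finrank ℂ (planeIn e w) = N := by
  have := (Submodule.equivMapOfInjective (coordDeriv e w.base : _ →ₗ[ℂ] Cn (N + 1))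
    (coordDeriv_injective he hw) w.plane).finrank_eq
  rw [w.finrank_plane] at this
  exact this.symm

theorem ofCoord_eq {e : OpenPartialHomeomorph M (Cn (N + 1))} (he : e ∈ HolCoord M)
    {q : Cn (N + 1) × Cn N} (hq : q.1 ∈ e.target) :
    ∃ h, ofCoord e q = ofPlane (e.symm q.1)
      ((graphPlane q.2).map (coordSymmDeriv e q.1 : Cn (N + 1) →ₗ[ℂ] Cn (N + 1))) h := by
  have h : Module.finrank ℂ
      ((graphPlane q.2).map (coordSymmDeriv e q.1 : Cn (N + 1) →ₗ[ℂ] Cn (N + 1))) = N := by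
    have := (Submodule.equivMapOfInjective (coordSymmDeriv e q.1 : Cn (N + 1) →ₗ[ℂ] Cn (N + 1))
      (coordSymmDeriv_injective he hq) (graphPlane q.2)).finrank_eq
    rw [finrank_graphPlane] at this
    exact this.symm
  exact ⟨h, by rw [ofCoord, dif_pos h]⟩

theorem base_ofCoord (e : OpenPartialHomeomorph M (Cn (N + 1)))
    (q : Cn (N + 1) × Cn N) : (ofCoord e q).base = e.symm q.1 := by
  unfold ofCoord; split_ifs <;> rfl

theorem planeIn_ofCoord {e : OpenPartialHomeomorph M (Cn (N + 1))} (he : e ∈ HolCoord M)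
    {q : Cn (N + 1) × Cn N} (hq : q.1 ∈ e.target) :
    planeIn e (ofCoord e q) = graphPlane q.2 := by
  obtain ⟨h, hw⟩ := ofCoord_eq he hq
  rw [hw]
  ext v
  constructor
  · rintro ⟨u, ⟨t, ht, rfl⟩, rfl⟩
    have := coordDeriv_coordSymmDeriv he hq t
    exact this.symm ▸ ht
  · intro hv
    exact ⟨coordSymmDeriv e q.1 v, ⟨v, hv, rfl⟩, coordDeriv_coordSymmDeriv he hq v⟩

/-- The coordinates `(x, p)` on the set of contact elements over the domain of the coordinates `x`
that do not contain `∂/∂x_n`. -/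
def stdCoord (e : OpenPartialHomeomorph M (Cn (N + 1))) (he : e ∈ HolCoord M) :
    PartialEquiv (ContactElement N M) (Cn (N + 1) × Cn N) where
  toFun w := (e w.base, planeSlope (planeIn e w))
  invFun := ofCoord e
  source := {w | w.base ∈ e.source ∧ basisVec (Fin.last N) ∉ planeIn e w}
  target := {q | q.1 ∈ e.target}
  map_source' w hw := e.map_source hw.1
  map_target' q hq := by
    refine ⟨?_, ?_⟩
    · rw [base_ofCoord]; exact e.map_target hq
    · rw [planeIn_ofCoord he hq, mem_graphPlane, eta_last]; exact one_ne_zero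
  left_inv' w hw := by
    obtain ⟨h, hw'⟩ := ofCoord_eq he (q := (e w.base, planeSlope (planeIn e w)))
      (e.map_source hw.1)
    rw [hw']
    refine ofPlane_congr (h' := w.finrank_plane) (e.left_inv hw.1) ?_ h
    rw [graphPlane_planeSlope (finrank_planeIn he hw.1) hw.2]
    ext v
    constructor
    · rintro ⟨u, ⟨t, ht, rfl⟩, rfl⟩
      have := coordSymmDeriv_coordDeriv he hw.1 t
      exact this.symm ▸ ht
    · intro hv
      exact ⟨coordDeriv e w.base v, ⟨v, hv, rfl⟩, coordSymmDeriv_coordDeriv he hw.1 v⟩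
  right_inv' q hq := by
    refine Prod.ext ?_ ?_
    · simp only [base_ofCoord]; exact e.right_inv hq
    · simp only [planeIn_ofCoord he hq, planeSlope_graphPlane]

theorem fderiv_transition {e e' : OpenPartialHomeomorph M (Cn (N + 1))} (he : e ∈ HolCoord M)
    (he' : e' ∈ HolCoord M) {m : M} (hm : m ∈ e.source) (hm' : m ∈ e'.source) (v : Cn (N + 1)) :
    fderiv ℂ (e'.symm.trans e) (e' m) v = coordDeriv e m (coordSymmDeriv e' (e' m) v) := by
  have h1 : MDifferentiableAt 𝓘(ℂ, Cn (N + 1)) 𝓘(ℂ, Cn (N + 1)) e'.symm (e' m) :=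
    (mdifferentiable_holCoord he').mdifferentiableAt_symm (e'.map_source hm')
  have h2 : MDifferentiableAt 𝓘(ℂ, Cn (N + 1)) 𝓘(ℂ, Cn (N + 1)) e (e'.symm (e' m)) := by
    rw [e'.left_inv hm']
    exact (mdifferentiable_holCoord he).mdifferentiableAt hm
  have h3 := mfderiv_comp (e' m) h2 h1
  have h4 : fderiv ℂ (e'.symm.trans e) (e' m) v =
      coordDeriv e (e'.symm (e' m)) (coordSymmDeriv e' (e' m) v) := by
    refine Eq.trans ?_ (DFunLike.congr_fun h3 v)
    exact DFunLike.congr_fun (mfderiv_eq_fderiv (f := e'.symm.trans e) (x := e' m)).symm v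
  have hT : ∀ m m' : M, m = m' → ∀ u : Cn (N + 1), (coordDeriv e m u) = coordDeriv e m' u := by
    rintro m _ rfl u; rfl
  exact h4.trans (hT _ _ (e'.left_inv hm') _)

/-- Membership in the hyperplane that a contact element given by its coordinates `(x, p)` becomes
in other coordinates. -/
theorem mem_planeIn_ofCoord {e e' : OpenPartialHomeomorph M (Cn (N + 1))} (he : e ∈ HolCoord M)
    (he' : e' ∈ HolCoord M) {q : Cn (N + 1) × Cn N} (hq : q.1 ∈ e.target)
    (hq' : e.symm q.1 ∈ e'.source) (v : Cn (N + 1)) :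
    v ∈ planeIn e' (ofCoord e q) ↔
      eta q.2 (fderiv ℂ (e'.symm.trans e) (e' (e.symm q.1)) v) = 0 := by
  obtain ⟨h, hw⟩ := ofCoord_eq he hq
  rw [hw, fderiv_transition he he' (e.map_target hq) hq']
  constructor
  · rintro ⟨u, ⟨t, ht, rfl⟩, rfl⟩
    have h5 : (coordSymmDeriv e' (e' (e.symm q.1))
        (coordDeriv e' (e.symm q.1) (coordSymmDeriv e q.1 t))) = coordSymmDeriv e q.1 t :=
      coordSymmDeriv_coordDeriv he' hq' (coordSymmDeriv e q.1 t)
    have h6 := coordDeriv_coordSymmDeriv he hq t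
    have h7 : coordDeriv e (e.symm q.1) (coordSymmDeriv e' (e' (e.symm q.1))
        (coordDeriv e' (e.symm q.1) (coordSymmDeriv e q.1 t))) = t :=
      (congrArg (fun z : Cn (N + 1) => coordDeriv e (e.symm q.1) z) h5).trans h6
    exact (congrArg (eta q.2) h7).trans ht
  · intro hv
    refine ⟨coordSymmDeriv e' (e' (e.symm q.1)) v, ⟨_, hv, ?_⟩, ?_⟩
    · have := coordSymmDeriv_coordDeriv he (e.map_target hq)
        (coordSymmDeriv e' (e' (e.symm q.1)) v)
      rw [e.right_inv hq] at this
      exact this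
    · have := coordDeriv_coordSymmDeriv he' (e'.map_source hq') v
      rw [e'.left_inv hq'] at this
      exact this

theorem contDiffOn_transition {e e' : OpenPartialHomeomorph M (Cn (N + 1))} (he : e ∈ HolCoord M)
    (he' : e' ∈ HolCoord M) : ContDiffOn ℂ ω (e.symm.trans e') (e.symm.trans e').source :=
  contMDiffOn_iff_contDiffOn.1 (contMDiffOn_of_mem_contDiffGroupoid
    ((contDiffGroupoid ω 𝓘(ℂ, Cn (N + 1))).compatible_of_mem_maximalAtlas he he'))

/-- The denominator in the change of coordinates on contact elements. -/
def transDenom (e e' : OpenPartialHomeomorph M (Cn (N + 1))) (q : Cn (N + 1) × Cn N)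
    (v : Cn (N + 1)) : ℂ :=
  eta q.2 (fderiv ℂ (e'.symm.trans e) ((e.symm.trans e') q.1) v)

theorem contDiffOn_transDenom {e e' : OpenPartialHomeomorph M (Cn (N + 1))} (he : e ∈ HolCoord M)
    (he' : e' ∈ HolCoord M) (v : Cn (N + 1)) :
    ContDiffOn ℂ ω (fun q : Cn (N + 1) × Cn N => transDenom e e' q v)
      {q | q.1 ∈ (e.symm.trans e').source} := by
  have h1 : ContDiffOn ℂ ω (fun x => fderiv ℂ (e'.symm.trans e) x) (e'.symm.trans e).source :=
    (contDiffOn_transition he' he).fderiv_of_isOpen (e'.symm.trans e).open_source (by simp)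
  have h2 : ContDiffOn ℂ ω (fun q : Cn (N + 1) × Cn N => (e.symm.trans e') q.1)
      {q | q.1 ∈ (e.symm.trans e').source} :=
    (contDiffOn_transition he he').comp contDiff_fst.contDiffOn (fun q hq => hq)
  have h3 : ContDiffOn ℂ ω (fun q : Cn (N + 1) × Cn N =>
      fderiv ℂ (e'.symm.trans e) ((e.symm.trans e') q.1) v) {q | q.1 ∈ (e.symm.trans e').source} := by
    refine ContDiffOn.clm_apply (h1.comp h2 ?_) contDiffOn_const
    intro q hq
    have : (e.symm.trans e') q.1 ∈ (e.symm.trans e').target := (e.symm.trans e').map_source hq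
    simpa using this
  simp only [transDenom, eta_apply]
  refine ContDiffOn.sub ?_ (ContDiffOn.sum fun α _ => ContDiffOn.mul ?_ ?_)
  · exact (EuclideanSpace.proj (𝕜 := ℂ) (Fin.last N)).contDiff.comp_contDiffOn h3
  · exact ((EuclideanSpace.proj (𝕜 := ℂ) α).contDiff.comp contDiff_snd).contDiffOn
  · exact (EuclideanSpace.proj (𝕜 := ℂ) α.castSucc).contDiff.comp_contDiffOn h3

theorem trans_source {e e' : OpenPartialHomeomorph M (Cn (N + 1))} (he : e ∈ HolCoord M)
    (he' : e' ∈ HolCoord M) :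
    ((stdCoord e he).symm.trans (stdCoord e' he')).source =
      {q : Cn (N + 1) × Cn N | q.1 ∈ (e.symm.trans e').source} ∩
        (fun q : Cn (N + 1) × Cn N => transDenom e e' q (basisVec (Fin.last N))) ⁻¹' {0}ᶜ := by
  ext q
  have key : q.1 ∈ e.target → e.symm q.1 ∈ e'.source →
      (basisVec (Fin.last N) ∈ planeIn e' (ofCoord e q) ↔
        transDenom e e' q (basisVec (Fin.last N)) = 0) :=
    fun h1 h2 => mem_planeIn_ofCoord he he' h1 h2 _
  constructor
  · rintro ⟨h1, h2, h3⟩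
    have h1' : q.1 ∈ e.target := h1
    have h2' : e.symm q.1 ∈ e'.source := by rw [← base_ofCoord]; exact h2
    exact ⟨⟨by simpa using h1', by simpa using h2'⟩, fun h => h3 ((key h1' h2').2 h)⟩
  · rintro ⟨⟨h1, h2⟩, h3⟩
    have h1' : q.1 ∈ e.target := by simpa using h1
    have h2' : e.symm q.1 ∈ e'.source := by simpa using h2
    refine ⟨h1', ?_, fun h => h3 ((key h1' h2').1 h)⟩
    have := base_ofCoord e q
    exact this ▸ h2'

theorem isOpen_trans_source {e e' : OpenPartialHomeomorph M (Cn (N + 1))} (he : e ∈ HolCoord M)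
    (he' : e' ∈ HolCoord M) :
    IsOpen ((stdCoord e he).symm.trans (stdCoord e' he')).source := by
  rw [trans_source]
  exact (contDiffOn_transDenom he he' _).continuousOn.isOpen_inter_preimage
    ((e.symm.trans e').open_source.preimage continuous_fst) isOpen_compl_singleton

theorem contDiffOn_trans {e e' : OpenPartialHomeomorph M (Cn (N + 1))} (he : e ∈ HolCoord M)
    (he' : e' ∈ HolCoord M) :
    ContDiffOn ℂ ω ((stdCoord e he).symm.trans (stdCoord e' he'))
      ((stdCoord e he).symm.trans (stdCoord e' he')).source := by
  rw [trans_source]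
  set S : Set (Cn (N + 1) × Cn N) := {q | q.1 ∈ (e.symm.trans e').source}
  have h1 : ContDiffOn ℂ ω (fun q : Cn (N + 1) × Cn N => (e.symm.trans e') q.1) S :=
    (contDiffOn_transition he he').comp contDiff_fst.contDiffOn (fun q hq => hq)
  have h2 : ContDiffOn ℂ ω (fun q : Cn (N + 1) × Cn N =>
      (WithLp.toLp 2 fun α : Fin N => - transDenom e e' q (basisVec α.castSucc) /
        transDenom e e' q (basisVec (Fin.last N)) : Cn N))
      (S ∩ (fun q => transDenom e e' q (basisVec (Fin.last N))) ⁻¹' {0}ᶜ) := by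
    rw [contDiffOn_euclidean]
    intro α
    exact (((contDiffOn_transDenom he he' _).mono inter_subset_left).neg).div
      ((contDiffOn_transDenom he he' _).mono inter_subset_left) (fun q hq => hq.2)
  refine ((h1.mono inter_subset_left).prodMk h2).congr ?_
  intro q hq
  have hq1 : q.1 ∈ e.target := by simpa using hq.1.1
  have hq2 : e.symm q.1 ∈ e'.source := by simpa using hq.1.2
  refine Prod.ext ?_ ?_
  · exact congrArg e' (base_ofCoord e q)
  · ext α
    exact planeSlope_apply_of_mem_iff
      ((eta q.2).comp (fderiv ℂ (e'.symm.trans e) (e' (e.symm q.1))))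
      (fun v => mem_planeIn_ofCoord he he' hq1 hq2 v) hq.2 α

variable [IsManifold 𝓘(ℂ, Cn (N + 1)) ω M]

/-- Near every point there are coordinates such that `∂/∂x_n` is not in a given hyperplane. -/
theorem exists_mem_stdCoord_source (w : ContactElement N M) :
    ∃ e : OpenPartialHomeomorph M (Cn (N + 1)), ∃ he : e ∈ HolCoord M,
      w ∈ (stdCoord e he).source := by
  set c := chartAt (Cn (N + 1)) w.base with hc
  have hcm : c ∈ HolCoord M := IsManifold.chart_mem_maximalAtlas w.base
  have hcs : w.base ∈ c.source := mem_chart_source _ _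
  have hfr : Module.finrank ℂ (planeIn c w) = N := finrank_planeIn hcm hcs
  obtain ⟨i, hi⟩ : ∃ i, (basisVec i : Cn (N + 1)) ∉ planeIn c w := by
    by_contra! hall
    have htop : planeIn c w = ⊤ := by
      rw [eq_top_iff]
      intro v _
      have hdec : v = ∑ i, v i • basisVec i := by
        ext j
        simp [basisVec, Pi.single_apply]
      rw [hdec]
      exact Submodule.sum_mem _ fun i _ => Submodule.smul_mem _ _ (hall i)
    rw [htop] at hfr
    simp at hfr
  let σ : Cn (N + 1) ≃L[ℂ] Cn (N + 1) :=
    (LinearIsometryEquiv.piLpCongrLeft 2 ℂ ℂ (Equiv.swap i (Fin.last N))).toContinuousLinearEquiv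
  have hσ : σ (basisVec i) = basisVec (Fin.last N) := by
    simp [σ, basisVec]
  let e : OpenPartialHomeomorph M (Cn (N + 1)) := c.trans σ.toHomeomorph.toOpenPartialHomeomorph
  have hes : w.base ∈ e.source := by simpa [e] using hcs
  have he : e ∈ HolCoord M := by
    rw [IsManifold.mem_maximalAtlas_iff_contMDiffOn]
    constructor
    · have h1 := contMDiffOn_of_mem_maximalAtlas hcm
      have h2 : ContMDiff 𝓘(ℂ, Cn (N + 1)) 𝓘(ℂ, Cn (N + 1)) ω σ := σ.contDiff.contMDiff
      have h3 := h2.comp_contMDiffOn h1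
      simpa [e] using h3
    · have h1 := contMDiffOn_symm_of_mem_maximalAtlas hcm
      have h2 : ContMDiff 𝓘(ℂ, Cn (N + 1)) 𝓘(ℂ, Cn (N + 1)) ω σ.symm :=
        σ.symm.contDiff.contMDiff
      have h3 := h1.comp (h2.contMDiffOn (s := e.target)) (by intro x hx; simpa [e] using hx)
      exact h3
  refine ⟨e, he, hes, ?_⟩
  rintro ⟨v, hv, hv'⟩
  apply hi
  refine ⟨v, hv, ?_⟩
  have h1 : coordDeriv e w.base v = σ (coordDeriv c w.base v) := by
    have h2 : MDifferentiableAt 𝓘(ℂ, Cn (N + 1)) 𝓘(ℂ, Cn (N + 1)) c w.base :=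
      (mdifferentiable_holCoord hcm).mdifferentiableAt hcs
    have h3 : MDifferentiableAt 𝓘(ℂ, Cn (N + 1)) 𝓘(ℂ, Cn (N + 1)) σ (c w.base) :=
      σ.differentiable.mdifferentiable _
    have h4 := DFunLike.congr_fun (mfderiv_comp w.base h3 h2) v
    refine Eq.trans h4 ?_
    have h5 : mfderiv 𝓘(ℂ, Cn (N + 1)) 𝓘(ℂ, Cn (N + 1)) σ (c w.base) =
        (σ : Cn (N + 1) →L[ℂ] Cn (N + 1)) :=
      (mfderiv_eq_fderiv (f := σ) (x := c w.base)).trans σ.fderiv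
    exact DFunLike.congr_fun h5 _
  have h6 : σ (coordDeriv c w.base v) = σ (basisVec i) := by
    rw [← h1, hσ]; exact hv'
  exact σ.injective h6

variable (N M) in
/-- The coordinates `(x, p)` are the charts of the manifold of contact elements. -/
def chartedSpaceCore : ChartedSpaceCore (Cn (N + 1) × Cn N) (ContactElement N M) where
  atlas := {c | ∃ (e : OpenPartialHomeomorph M (Cn (N + 1))) (he : e ∈ HolCoord M),
    c = stdCoord e he}
  chartAt w := stdCoord (exists_mem_stdCoord_source w).choose
    (exists_mem_stdCoord_source w).choose_spec.choose
  mem_chart_source w := (exists_mem_stdCoord_source w).choose_spec.choose_spec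
  chart_mem_atlas w := ⟨_, _, rfl⟩
  open_source := by
    rintro _ _ ⟨e, he, rfl⟩ ⟨e', he', rfl⟩
    exact isOpen_trans_source he he'
  continuousOn_toFun := by
    rintro _ _ ⟨e, he, rfl⟩ ⟨e', he', rfl⟩
    exact (contDiffOn_trans he he').continuousOn

instance : TopologicalSpace (ContactElement N M) := (chartedSpaceCore N M).toTopologicalSpace

instance : ChartedSpace (Cn (N + 1) × Cn N) (ContactElement N M) :=
  (chartedSpaceCore N M).toChartedSpace

/-- The chart `(x, p)` of the manifold of contact elements that is attached to coordinates `x`. -/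
def stdChart (e : OpenPartialHomeomorph M (Cn (N + 1))) (he : e ∈ HolCoord M) :
    OpenPartialHomeomorph (ContactElement N M) (Cn (N + 1) × Cn N) :=
  (chartedSpaceCore N M).openPartialHomeomorph (stdCoord e he) ⟨e, he, rfl⟩

theorem mem_atlas_iff {c : OpenPartialHomeomorph (ContactElement N M) (Cn (N + 1) × Cn N)} :
    c ∈ atlas (Cn (N + 1) × Cn N) (ContactElement N M) ↔
      ∃ (e : OpenPartialHomeomorph M (Cn (N + 1))) (he : e ∈ HolCoord M), c = stdChart e he := by
  constructor
  · intro hc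
    obtain ⟨c', hcc'⟩ := mem_iUnion.1 hc
    obtain ⟨⟨e, he, rfl⟩, h⟩ := mem_iUnion.1 hcc'
    exact ⟨e, he, h⟩
  · rintro ⟨e, he, rfl⟩
    exact mem_iUnion.2 ⟨stdCoord e he, mem_iUnion.2 ⟨⟨e, he, rfl⟩, rfl⟩⟩

/-- The manifold `M̃` of contact elements is a complex manifold of dimension `2n - 1`. -/
instance : IsManifold 𝓘(ℂ, Cn (N + 1) × Cn N) ω (ContactElement N M) := by
  apply isManifold_of_contDiffOn
  intro c c' hc hc'
  obtain ⟨e, he, rfl⟩ := mem_atlas_iff.1 hc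
  obtain ⟨e', he', rfl⟩ := mem_atlas_iff.1 hc'
  simpa using! contDiffOn_trans he he'

end ContactElement
end ContactElements

section Analytic

variable {V : Type*} [NormedAddCommGroup V] [NormedSpace ℂ V]
  {X : Type*} [TopologicalSpace X] [ChartedSpace V X]

/-- A closed analytic subset: closed, and near each of its points the set of common zeros of
finitely many holomorphic functions. -/
def IsAnalyticSubset (A : Set X) : Prop :=
  IsClosed A ∧ ∀ x ∈ A, ∃ U : Set X, IsOpen U ∧ x ∈ U ∧ ∃ (s : ℕ) (f : Fin s → X → ℂ),
    (∀ i, ContMDiffOn 𝓘(ℂ, V) 𝓘(ℂ, ℂ) ω (f i) U) ∧ ∀ y ∈ U, y ∈ A ↔ ∀ i, f i y = 0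

/-- `A` is near its point `x` a complex submanifold of dimension `k`: it is a `k`-dimensional affine
subspace in suitable holomorphic coordinates. -/
def IsRegularPoint (A : Set X) (k : ℕ) (x : X) : Prop :=
  x ∈ A ∧ ∃ ψ ∈ IsManifold.maximalAtlas 𝓘(ℂ, V) ω X, x ∈ ψ.source ∧
    ∃ L : Submodule ℂ V, Module.finrank ℂ L = k ∧ ∀ y ∈ ψ.source, y ∈ A ↔ ψ y - ψ x ∈ L

/-- The analytic set `A` has pure dimension `k`: it is the closure of its regular points of
dimension `k`. -/
def HasPureDim (A : Set X) (k : ℕ) : Prop :=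
  A ⊆ closure {x | IsRegularPoint (V := V) A k x}

/-- The analytic set `A` is empty or has dimension at most `k`: all its regular points are of
dimension at most `k`. -/
def HasDimLE (A : Set X) (k : ℕ) : Prop :=
  ∀ j x, IsRegularPoint (V := V) A j x → j ≤ k

/-- The tangent space of `A` at `x`: the vectors killed by the differentials of all holomorphic
functions near `x` that vanish on `A`. At a regular point it is the tangent space of the
submanifold `A`. -/
def tangentAlong (A : Set X) (x : X) : Submodule ℂ (TangentSpace 𝓘(ℂ, V) x) where
  carrier := {v | ∀ f : X → ℂ, ContMDiffAt 𝓘(ℂ, V) 𝓘(ℂ, ℂ) ω f x → (∀ᶠ y in 𝓝[A] x, f y = 0) →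
    mfderiv 𝓘(ℂ, V) 𝓘(ℂ, ℂ) f x v = 0}
  add_mem' hu hv f hf h0 := by
    rw [map_add, hu f hf h0, hv f hf h0, add_zero]
  zero_mem' f _ _ := map_zero _
  smul_mem' c v hv f hf h0 := by
    rw [map_smul, hv f hf h0, smul_zero]

end Analytic

section Webs

variable {N : ℕ} {M : Type*} [TopologicalSpace M] [ChartedSpace (Cn (N + 1)) M]
  [IsManifold 𝓘(ℂ, Cn (N + 1)) ω M]

/-- The differential at `w` of the projection `π : M̃ → M`. -/
def projDeriv (w : ContactElement N M) :
    TangentSpace 𝓘(ℂ, Cn (N + 1) × Cn N) w →L[ℂ] TangentSpace 𝓘(ℂ, Cn (N + 1)) w.base :=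
  mfderiv 𝓘(ℂ, Cn (N + 1) × Cn N) 𝓘(ℂ, Cn (N + 1))
    (ContactElement.base : ContactElement N M → M) w

/-- The tautological contact form `ω : T M̃ → L`, where the fibre of `L` at the contact element `w`
is the quotient of the tangent space of `M` by the hyperplane `w`. -/
def contactForm (w : ContactElement N M) :
    TangentSpace 𝓘(ℂ, Cn (N + 1) × Cn N) w →ₗ[ℂ]
      (TangentSpace 𝓘(ℂ, Cn (N + 1)) w.base ⧸ w.plane) :=
  w.plane.mkQ ∘ₗ (projDeriv w : _ →ₗ[ℂ] TangentSpace 𝓘(ℂ, Cn (N + 1)) w.base)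

/-- The exterior derivative `dη = ∑_α dx_α ∧ dp_α` of `η = dx_n - ∑_α p_α dx_α`. -/
def dEta (u v : Cn (N + 1) × Cn N) : ℂ :=
  ∑ α : Fin N, (u.1 α.castSucc * v.2 α - v.1 α.castSucc * u.2 α)

/-- The value of `η ∧ dη` at the point `q = (x, p)` on three vectors. -/
def etaWedgeDEta (q u v z : Cn (N + 1) × Cn N) : ℂ :=
  eta q.2 u.1 * dEta v z + eta q.2 v.1 * dEta z u + eta q.2 z.1 * dEta u v

/-- The part of `W` over the point `m` of `M`. -/
def fibreAt (W : Set (ContactElement N M)) (m : M) : Set (ContactElement N M) :=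
  {w | w ∈ W ∧ w.base = m}

/-- The regular part `W'` of a subset of pure dimension `n = N + 1`. -/
def regularPart (W : Set (ContactElement N M)) : Set (ContactElement N M) :=
  {w | IsRegularPoint (V := Cn (N + 1) × Cn N) W (N + 1) w}

/-- The critical set `Γ_W`: the points where `W` is singular or where the differential of the
projection `W' → M` is not an isomorphism. -/
def criticalSet (W : Set (ContactElement N M)) : Set (ContactElement N M) :=
  {w | w ∈ W ∧ (w ∉ regularPart W ∨
    ¬ Function.Bijective fun v : tangentAlong (V := Cn (N + 1) × Cn N) W w => projDeriv w v.1)}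

/-- The regular part `M_0` of `M`, the complement of the caustic `π(Γ_W)`. -/
def regularBase (W : Set (ContactElement N M)) : Set M :=
  (ContactElement.base '' criticalSet W)ᶜ

/-- The restriction of the contact form to `W'` is integrable: `η ∧ dη` vanishes on the tangent
spaces of `W'`, in all coordinates `(x, p)`. -/
def ContactFormIntegrable (W : Set (ContactElement N M)) : Prop :=
  ∀ w ∈ regularPart W, ∀ (e : OpenPartialHomeomorph M (Cn (N + 1))) (he : e ∈ HolCoord M),
    w ∈ (ContactElement.stdChart e he).source →
    ∀ u ∈ tangentAlong (V := Cn (N + 1) × Cn N) W w,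
    ∀ v ∈ tangentAlong (V := Cn (N + 1) × Cn N) W w,
    ∀ z ∈ tangentAlong (V := Cn (N + 1) × Cn N) W w,
      etaWedgeDEta (ContactElement.stdChart e he w)
        (mfderiv 𝓘(ℂ, Cn (N + 1) × Cn N) 𝓘(ℂ, Cn (N + 1) × Cn N)
          (ContactElement.stdChart e he) w u)
        (mfderiv 𝓘(ℂ, Cn (N + 1) × Cn N) 𝓘(ℂ, Cn (N + 1) × Cn N)
          (ContactElement.stdChart e he) w v)
        (mfderiv 𝓘(ℂ, Cn (N + 1) × Cn N) 𝓘(ℂ, Cn (N + 1) × Cn N)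
          (ContactElement.stdChart e he) w z) = 0

/-- The fibre of `W` over `m` is finite, of degree `d` when every point `w` is counted with its
multiplicity `μ w`, the number of points near `w` in the fibres over the points of `M_0`
near `m`. -/
def FibreHasDegree (d : ℕ) (W : Set (ContactElement N M)) (m : M) : Prop :=
  (fibreAt W m).Finite ∧ ∃ μ : ContactElement N M → ℕ,
    (∀ w ∈ fibreAt W m, 0 < μ w ∧ ∀ O ∈ 𝓝 w, ∃ O' ∈ 𝓝 w, O' ⊆ O ∧
      ∀ᶠ m' in 𝓝[regularBase W] m, (O' ∩ fibreAt W m').ncard = μ w) ∧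
    ∑ᶠ w ∈ fibreAt W m, μ w = d

/-- `W` is a `d`-web (of codimension one) on the complex manifold `M` of dimension `n = N + 1`: an
analytic subset of `M̃` of pure dimension `n` that projects onto `M`, on whose regular part the
contact form is integrable, which is a `d`-fold covering over `M_0`, whose critical set has
dimension at most `n - 1`, and whose fibres are finite of degree `d`. -/
structure IsWeb (d : ℕ) (W : Set (ContactElement N M)) : Prop where
  one_le : 1 ≤ d
  analytic : IsAnalyticSubset (V := Cn (N + 1) × Cn N) W
  pureDim : HasPureDim (V := Cn (N + 1) × Cn N) W (N + 1)
  surjective : ∀ m : M, (fibreAt W m).Nonempty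
  integrable : ContactFormIntegrable W
  covering : IsCoveringMapOn (fun w : W => w.1.base) (regularBase W)
  card_fibre : ∀ m ∈ regularBase W, (fibreAt W m).ncard = d
  critical_dim : HasDimLE (V := Cn (N + 1) × Cn N) (criticalSet W) N
  fibre_degree : ∀ m : M, FibreHasDegree d W m

/-- The irreducible components of `W`: the closures of the connected components of its regular
part. -/
def IsWebComponent (W C : Set (ContactElement N M)) : Prop :=
  ∃ w ∈ regularPart W, C = closure (connectedComponentIn (regularPart W) w)

/-- Holomorphic vector fields `ξ_1, …, ξ_{n-1}` of `M̃` near `x` that are, along `C`, tangent to `C`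
and in the kernel of the contact form. -/
def IsKernelFamily (C : Set (ContactElement N M)) (x : ContactElement N M)
    (ξ : Fin N → (y : ContactElement N M) → TangentSpace 𝓘(ℂ, Cn (N + 1) × Cn N) y) : Prop :=
  ∀ i, ContMDiffAt 𝓘(ℂ, Cn (N + 1) × Cn N) 𝓘(ℂ, Cn (N + 1) × Cn N).tangent ω
      (fun y => (⟨y, ξ i y⟩ : TangentBundle 𝓘(ℂ, Cn (N + 1) × Cn N) (ContactElement N M))) x ∧
    ∀ᶠ y in 𝓝[C] x, ξ i y ∈ tangentAlong (V := Cn (N + 1) × Cn N) C y ∧ contactForm y (ξ i y) = 0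

/-- The web is dicritical on the component `C`: the foliation of codimension one on the regular part
`C'` of `C` that is defined by the vector fields in the kernel of the contact form has no
singularity, that is, near each point of `C'` there are `n - 1` of these vector fields that are
linearly independent at this point. -/
def IsDicriticalOn (C : Set (ContactElement N M)) : Prop :=
  ∀ x ∈ regularPart C, ∃ ξ, IsKernelFamily C x ξ ∧ LinearIndependent ℂ fun i => ξ i x

/-- The web is dicritical: it is dicritical on each irreducible component. -/
def IsDicritical (W : Set (ContactElement N M)) : Prop :=
  ∀ C, IsWebComponent W C → IsDicriticalOn C

/-- The natural map that lifts the vectors of the tautological bundle `T ⊆ π⁻¹(TM)` to vectors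
tangent to `C`, defined by `(dπ)⁻¹` off the critical set, extends to an injective holomorphic
morphism from `T` to the tangent bundle of `C'`: near each point `x` of `C'` there are
holomorphic vector fields tangent to `C` whose images by `dπ` form a frame of `T` near `x`. -/
def TautologicalLiftExtends (C : Set (ContactElement N M)) : Prop :=
  ∀ x ∈ regularPart C, ∃ ξ, IsKernelFamily C x ξ ∧
    LinearIndependent ℂ fun i => projDeriv x (ξ i x)

/-- A leaf of the web, possibly small: a complex hypersurface `H` of `M` whose tangent hyperplanes
belong to `W_0 = W \ Γ_W`. Locally `W_0` is the graph of a field of hyperplanes, and `H` is an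
integral hypersurface of one of these fields. -/
def IsWebLeaf (W : Set (ContactElement N M)) (H : Set M) : Prop :=
  ∀ m ∈ H, IsRegularPoint (V := Cn (N + 1)) H N m ∧
    ∃ w ∈ W \ criticalSet W, w.base = m ∧ w.plane = tangentAlong (V := Cn (N + 1)) H w.base

/-- In the coordinates `e`, the leaves of the web have affine equations: near `π(w)`, the leaf of
the web through each `w ∈ W_0` over the domain of `e` has an equation `ℓ(x) = c` with a linear
form `ℓ`. -/
def LeavesAffineIn (W : Set (ContactElement N M)) (e : OpenPartialHomeomorph M (Cn (N + 1))) :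
    Prop :=
  ∀ w ∈ W \ criticalSet W, w.base ∈ e.source →
    ∃ (ℓ : Cn (N + 1) →L[ℂ] ℂ) (c : ℂ) (O : Set M), ℓ ≠ 0 ∧ IsOpen O ∧ w.base ∈ O ∧
      O ⊆ e.source ∧ ℓ (e w.base) = c ∧ IsWebLeaf W {m | m ∈ O ∧ ℓ (e m) = c} ∧
      w.plane = tangentAlong (V := Cn (N + 1)) {m | m ∈ O ∧ ℓ (e m) = c} w.base

/-- The web is totally linearizable: near any point of `M` (on the caustic or not) there are
holomorphic coordinates in which the leaves of the web have affine equations. -/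
def IsTotallyLinearizable (W : Set (ContactElement N M)) : Prop :=
  ∀ m : M, ∃ e ∈ HolCoord M, m ∈ e.source ∧ LeavesAffineIn W e

/-- `Θ_α = ∂F/∂x_α + p_α ∂F/∂x_n` for a function `F` of the coordinates `(x, p)`. -/
def thetaCoeff (F : Cn (N + 1) × Cn N → ℂ) (q : Cn (N + 1) × Cn N) (α : Fin N) : ℂ :=
  fderiv ℂ F q (basisVec α.castSucc, 0) + q.2 α * fderiv ℂ F q (basisVec (Fin.last N), 0)

/-- In the coordinates `(x, p)` attached to `e`, the coefficients `Θ_α` of every local holomorphic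
equation `F = 0` of `W` vanish on `W`. -/
def ThetaVanishes (W : Set (ContactElement N M)) (e : OpenPartialHomeomorph M (Cn (N + 1)))
    (he : e ∈ HolCoord M) : Prop :=
  ∀ w ∈ W, w ∈ (ContactElement.stdChart e he).source → ∀ F : Cn (N + 1) × Cn N → ℂ,
    AnalyticAt ℂ F (ContactElement.stdChart e he w) →
    (∀ᶠ y in 𝓝[W] w, F (ContactElement.stdChart e he y) = 0) →
    ∀ α, thetaCoeff F (ContactElement.stdChart e he w) α = 0

end Webs

end

/-! ### Local structure of an analytic set at a regular point. -/

section RegularPoints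

variable {V : Type*} [NormedAddCommGroup V] [NormedSpace ℂ V]
  {X : Type*} [TopologicalSpace X] [ChartedSpace V X]

/-! In coordinates where the leaves are affine, a leaf is a piece of hyperplane, so its slopes `p`
are constant along it. Since the tangent hyperplanes of a leaf all belong to `W`, moving `x` from a
point of `W_0` along the leaf while keeping `p` fixed stays in `W`. The vectors `(∂/∂x_α + p_α
∂/∂x_n, 0)` are therefore velocities of curves in `W`, and every `F` vanishing on `W` has `Θ_α = 0`
there (`LeavesAffineIn.thetaVanishesAt`).

These vectors are defined by one polynomial formula on the whole chart, with no reference to the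
caustic. Hence `Θ_α = 0` passes to limits (`ThetaVanishesAt.of_mem_closure`). It reaches all of `W`
because `W_0` is dense: the regular part is dense and has dimension `n`, while the critical set has
dimension at most `n - 1`.

For a component `C`, the points of `W_0` near which `C` and `W` coincide are dense in `C`
(`IsWebComponent.subset_closure_eq_nhdsWithin`), so the same limit argument makes the fields
`liftField` tangent to `C`. They lie in the kernel of the contact form, and `dπ` sends them to a
frame of the tautological bundle. This is the extended lift; since the images under `dπ` are
independent, so are the fields, and the web is dicritical. -/

theorem IsRegularPoint.congr_of_open {A B U : Set X} {k : ℕ} {x : X}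
    (h : IsRegularPoint (V := V) A k x) (hU : IsOpen U) (hx : x ∈ U)
    (hAB : ∀ y ∈ U, y ∈ A ↔ y ∈ B) : IsRegularPoint (V := V) B k x := by
  obtain ⟨hxA, ψ, hψ, hxψ, L, hL, hA⟩ := h
  refine ⟨(hAB x hx).1 hxA, ψ.restr U, restr_mem_maximalAtlas _ hψ hU, ?_, L, hL, ?_⟩
  · rw [ψ.restr_source' U hU]; exact ⟨hxψ, hx⟩
  · intro y hy
    rw [ψ.restr_source' U hU] at hy
    rw [← hAB y hy.2, hA y hy.1]
    rfl

/-- Near a regular point of dimension `k`, the set consists of regular points of dimension `k`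
and is connected. -/
theorem IsRegularPoint.exists_open_isPreconnected {A : Set X} {k : ℕ} {x : X}
    (h : IsRegularPoint (V := V) A k x) :
    ∃ U : Set X, IsOpen U ∧ x ∈ U ∧ IsPreconnected (A ∩ U) ∧
      ∀ y ∈ A ∩ U, IsRegularPoint (V := V) A k y := by
  obtain ⟨hxA, ψ, hψ, hxψ, L, hL, hA⟩ := h
  obtain ⟨r, hr, hball⟩ := Metric.isOpen_iff.1 ψ.open_target (ψ x) (ψ.map_source hxψ)
  refine ⟨ψ.source ∩ ψ ⁻¹' Metric.ball (ψ x) r, ψ.isOpen_inter_preimage Metric.isOpen_ball,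
    ⟨hxψ, Metric.mem_ball_self hr⟩, ?_, ?_⟩
  · have himage : A ∩ (ψ.source ∩ ψ ⁻¹' Metric.ball (ψ x) r) =
        ψ.symm '' (Metric.ball (ψ x) r ∩ {v | v - ψ x ∈ L}) := by
      ext y
      constructor
      · rintro ⟨hyA, hyψ, hyr⟩
        exact ⟨ψ y, ⟨hyr, (hA y hyψ).1 hyA⟩, ψ.left_inv hyψ⟩
      · rintro ⟨v, ⟨hvr, hvL⟩, rfl⟩
        have hv := ψ.map_target (hball hvr)
        refine ⟨(hA _ hv).2 ?_, hv, ?_⟩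
        · rw [ψ.right_inv (hball hvr)]; exact hvL
        · rw [mem_preimage, ψ.right_inv (hball hvr)]; exact hvr
    rw [himage]
    refine IsPreconnected.image ?_ _
      (ψ.continuousOn_symm.mono (inter_subset_left.trans hball))
    let := NormedSpace.restrictScalars ℝ ℂ V
    refine Convex.isPreconnected ((convex_ball _ _).inter ?_)
    intro u hu v hv a b _ _ hab
    have hu' : u - ψ x ∈ L.restrictScalars ℝ := hu
    have hv' : v - ψ x ∈ L.restrictScalars ℝ := hv
    have key : a • u + b • v - ψ x = a • (u - ψ x) + b • (v - ψ x) := by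
      have hx1 : ψ x = (a + b) • ψ x := by rw [hab, one_smul]
      rw [smul_sub, smul_sub]
      nth_rewrite 1 [hx1]
      rw [add_smul]
      abel
    have hmem : a • u + b • v - ψ x ∈ L.restrictScalars ℝ :=
      key ▸ add_mem (Submodule.smul_mem _ a hu') (Submodule.smul_mem _ b hv')
    exact hmem
  · rintro y ⟨hyA, hyψ, -⟩
    refine ⟨hyA, ψ, hψ, hyψ, L, hL, fun z hz => ?_⟩
    rw [hA z hz]
    have hy := (hA y hyψ).1 hyA
    constructor
    · intro hzL
      simpa using L.sub_mem hzL hy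
    · intro hzL
      simpa using L.add_mem hzL hy

end RegularPoints

/-! ### Density of the non-critical points in the web and in its components. -/

section WebDensity

variable {N : ℕ} {M : Type*} [TopologicalSpace M] [ChartedSpace (Cn (N + 1)) M]
  [IsManifold 𝓘(ℂ, Cn (N + 1)) ω M] {W : Set (ContactElement N M)}

/-- A critical set of dimension at most `n - 1` has empty interior in the regular part. -/
theorem regularPart_subset_closure_diff_criticalSet
    (hdim : HasDimLE (V := Cn (N + 1) × Cn N) (criticalSet W) N) :
    regularPart W ⊆ closure (W \ criticalSet W) := by
  intro w hw
  by_contra hcl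
  -- Off the closure of `W_0` the sets `W` and `criticalSet W` coincide, so `w` would be a regular
  -- point of dimension `N + 1` of a set of dimension at most `N`.
  have hcrit : IsRegularPoint (V := Cn (N + 1) × Cn N) (criticalSet W) (N + 1) w := by
    refine IsRegularPoint.congr_of_open hw isClosed_closure.isOpen_compl hcl fun y hy => ?_
    refine ⟨fun hyW => ?_, fun h => h.1⟩
    by_contra hyc
    exact hy (subset_closure ⟨hyW, hyc⟩)
  have := hdim _ _ hcrit
  omega

theorem subset_closure_diff_criticalSet
    (hpure : HasPureDim (V := Cn (N + 1) × Cn N) W (N + 1))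
    (hdim : HasDimLE (V := Cn (N + 1) × Cn N) (criticalSet W) N) :
    W ⊆ closure (W \ criticalSet W) :=
  hpure.trans (closure_minimal (regularPart_subset_closure_diff_criticalSet hdim) isClosed_closure)

/-- Components of the regular part are relatively open in `W`: a regular point has a connected
neighbourhood in `W` made of regular points, and its component absorbs that neighbourhood. -/
theorem connectedComponentIn_regularPart_mem_nhdsWithin {w z : ContactElement N M}
    (hz : z ∈ connectedComponentIn (regularPart W) w) :
    ∃ U : Set (ContactElement N M), IsOpen U ∧ z ∈ U ∧
      W ∩ U ⊆ connectedComponentIn (regularPart W) w := by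
  have hzr : z ∈ regularPart W := connectedComponentIn_subset _ _ hz
  obtain ⟨U, hU, hzU, hconn, hreg⟩ := IsRegularPoint.exists_open_isPreconnected hzr
  refine ⟨U, hU, hzU, ?_⟩
  rw [connectedComponentIn_eq hz]
  exact hconn.subset_connectedComponentIn ⟨hzr.1, hzU⟩ hreg

/-- An irreducible component is the closure of the set of non-critical points near which it
coincides with the web. -/
theorem IsWebComponent.subset_closure_eq_nhdsWithin {C : Set (ContactElement N M)} (hC : IsWebComponent W C)
    (hclosed : IsClosed W)
    (hdim : HasDimLE (V := Cn (N + 1) × Cn N) (criticalSet W) N) :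
    C ⊆ closure {z | z ∈ C ∧ z ∈ W \ criticalSet W ∧ 𝓝[C] z = 𝓝[W] z} := by
  obtain ⟨w, hw, rfl⟩ := hC
  set K := connectedComponentIn (regularPart W) w
  have hKW : K ⊆ W := (connectedComponentIn_subset _ _).trans fun z hz => hz.1
  have hCW : closure K ⊆ W := closure_minimal hKW hclosed
  refine closure_minimal (fun z hz => ?_) isClosed_closure
  obtain ⟨U, hU, hzU, hUK⟩ := connectedComponentIn_regularPart_mem_nhdsWithin hz
  have hzcl := regularPart_subset_closure_diff_criticalSet hdim (connectedComponentIn_subset _ _ hz)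
  refine closure_mono ?_ ((hU.inter_closure) ⟨hzU, hzcl⟩)
  rintro y ⟨hyU, hyW⟩
  have hyK : y ∈ K := hUK ⟨hyW.1, hyU⟩
  -- The germs at `y` agree because `W ∩ U ⊆ K ⊆ closure K ⊆ W`.
  refine ⟨subset_closure hyK, hyW, le_antisymm (nhdsWithin_mono _ hCW) ?_⟩
  rw [← nhdsWithin_inter_of_mem' (mem_nhdsWithin_of_mem_nhds (hU.mem_nhds hyU) : U ∈ 𝓝[W] y)]
  exact nhdsWithin_mono _ (hUK.trans subset_closure)

end WebDensity

/-! ### Contact elements tangent to an affine hyperplane. -/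

section AffineEquations

variable {N : ℕ} {M : Type*} [TopologicalSpace M] [ChartedSpace (Cn (N + 1)) M]
  {e : OpenPartialHomeomorph M (Cn (N + 1))}

theorem finrank_ker_of_ne_zero {ℓ : Cn (N + 1) →L[ℂ] ℂ} (hℓ : ℓ ≠ 0) :
    Module.finrank ℂ (LinearMap.ker (ℓ : Cn (N + 1) →ₗ[ℂ] ℂ)) = N := by
  have hs : LinearMap.range (ℓ : Cn (N + 1) →ₗ[ℂ] ℂ) = ⊤ := by
    refine LinearMap.range_eq_top.2 (LinearMap.surjective ?_)
    intro h
    exact hℓ (ContinuousLinearMap.coe_injective h)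
  have h := LinearMap.finrank_range_add_finrank_ker (ℓ : Cn (N + 1) →ₗ[ℂ] ℂ)
  rw [hs] at h
  simp at h
  omega

/-- In coordinates, a contact element tangent to an affine hyperplane is its direction. -/
theorem planeIn_eq_ker (he : e ∈ HolCoord M) {ℓ : Cn (N + 1) →L[ℂ] ℂ} (hℓ : ℓ ≠ 0) {c : ℂ}
    {O : Set M} {w : ContactElement N M} (hw : w.base ∈ e.source)
    (hT : w.plane = tangentAlong (V := Cn (N + 1)) {m | m ∈ O ∧ ℓ (e m) = c} w.base) :
    ContactElement.planeIn e w = LinearMap.ker (ℓ : Cn (N + 1) →ₗ[ℂ] ℂ) := by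
  refine Submodule.eq_of_le_of_finrank_eq ?_ ?_
  · rintro _ ⟨u, hu, rfl⟩
    have hu' : u ∈ tangentAlong (V := Cn (N + 1)) {m | m ∈ O ∧ ℓ (e m) = c} w.base := hT ▸ hu
    have hsm : ContMDiffAt 𝓘(ℂ, Cn (N + 1)) 𝓘(ℂ, Cn (N + 1)) ω e w.base :=
      contMDiffAt_of_mem_maximalAtlas he hw
    have hg : ContDiff ℂ ω fun x : Cn (N + 1) => ℓ x - c := ℓ.contDiff.sub contDiff_const
    -- Testing tangency on the single function `ℓ ∘ e - c` gives one inclusion; equality then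
    -- follows because both sides have dimension `N`.
    have h := hu' (fun m => ℓ (e m) - c)
      (ContMDiffAt.comp w.base hg.contMDiff.contMDiffAt hsm)
      (eventually_mem_nhdsWithin.mono fun m hm => sub_eq_zero.2 hm.2)
    have hd : mfderiv 𝓘(ℂ, Cn (N + 1)) 𝓘(ℂ, ℂ) (fun m => ℓ (e m) - c) w.base u =
        ℓ (coordDeriv e w.base u) := by
      have h1 : MDifferentiableAt 𝓘(ℂ, Cn (N + 1)) 𝓘(ℂ, ℂ) (fun x => ℓ x - c) (e w.base) :=
        hg.contMDiff.contMDiffAt.mdifferentiableAt (by simp)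
      have h2 := DFunLike.congr_fun
        (mfderiv_comp w.base h1 (hsm.mdifferentiableAt (by simp))) u
      refine h2.trans ?_
      have h3 : mfderiv 𝓘(ℂ, Cn (N + 1)) 𝓘(ℂ, ℂ) (fun x => ℓ x - c) (e w.base) = ℓ := by
        refine mfderiv_eq_fderiv.trans ?_
        rw [fderiv_sub_const]
        exact ℓ.fderiv
      exact DFunLike.congr_fun h3 _
    exact hd.symm.trans h
  · rw [ContactElement.finrank_planeIn he hw, finrank_ker_of_ne_zero hℓ]

end AffineEquations

/-! ### Vanishing of the coefficients `Θ_α` along the web. -/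

section Theta

variable {N : ℕ} {M : Type*} [TopologicalSpace M] [ChartedSpace (Cn (N + 1)) M]
  [IsManifold 𝓘(ℂ, Cn (N + 1)) ω M]

/-- The lift `(∂/∂x_α + p_α ∂/∂x_n, 0)` to the space of coordinates `(x, p)` of a vector of the
hyperplane with slopes `p`. -/
noncomputable def horizontalLift (q : Cn (N + 1) × Cn N) (α : Fin N) : Cn (N + 1) × Cn N :=
  (basisVec α.castSucc + q.2 α • basisVec (Fin.last N), 0)

theorem thetaCoeff_eq_fderiv (F : Cn (N + 1) × Cn N → ℂ) (q : Cn (N + 1) × Cn N) (α : Fin N) :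
    thetaCoeff F q α = fderiv ℂ F q (horizontalLift q α) := by
  have : horizontalLift q α = (basisVec α.castSucc, 0) + q.2 α • (basisVec (Fin.last N), 0) := by
    simp [horizontalLift]
  rw [this, map_add, map_smul]
  rfl

theorem horizontalLift_fst_mem_graphPlane (q : Cn (N + 1) × Cn N) (α : Fin N) :
    (horizontalLift q α).1 ∈ graphPlane q.2 := by
  simp [horizontalLift, mem_graphPlane, eta_castSucc, eta_last]

theorem contDiff_horizontalLift (α : Fin N) :
    ContDiff ℂ ω fun q : Cn (N + 1) × Cn N => horizontalLift q α := by
  have h : ContDiff ℂ ω fun q : Cn (N + 1) × Cn N => q.2 α :=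
    (EuclideanSpace.proj (𝕜 := ℂ) α).contDiff.comp contDiff_snd
  exact (contDiff_const.add (h.smul contDiff_const)).prodMk contDiff_const

theorem linearIndependent_horizontalLift_fst (q : Cn (N + 1) × Cn N) :
    LinearIndependent ℂ fun α => (horizontalLift q α).1 := by
  rw [Fintype.linearIndependent_iff]
  intro g hg α
  have h := congrArg (fun v : Cn (N + 1) => v α.castSucc) hg
  simpa [horizontalLift, basisVec, Pi.single_apply, Fin.castSucc_ne_last] using h

/-- The coefficients `Θ_α` of all holomorphic functions that vanish on `A` near `y` vanish
at `y`. -/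
def ThetaVanishesAt (A : Set (ContactElement N M)) (e : OpenPartialHomeomorph M (Cn (N + 1)))
    (he : e ∈ HolCoord M) (y : ContactElement N M) : Prop :=
  ∀ F : Cn (N + 1) × Cn N → ℂ, AnalyticAt ℂ F (ContactElement.stdChart e he y) →
    (∀ᶠ z in 𝓝[A] y, F (ContactElement.stdChart e he z) = 0) →
    ∀ α, thetaCoeff F (ContactElement.stdChart e he y) α = 0

variable {e : OpenPartialHomeomorph M (Cn (N + 1))} {he : e ∈ HolCoord M}
  {A D : Set (ContactElement N M)}

/-- A function `F` that is analytic at `y` and vanishes on `A` near `y` has both properties at all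
nearby points of `D`, so `Θ_α` vanishes there. As `Θ_α` is continuous, it vanishes at the limit `y`.
-/
theorem ThetaVanishesAt.of_mem_closure (hDA : D ⊆ A) {y : ContactElement N M}
    (hyD : y ∈ closure D) (hy : y ∈ (ContactElement.stdChart e he).source)
    (hD : ∀ z ∈ D, z ∈ (ContactElement.stdChart e he).source → ThetaVanishesAt A e he z) :
    ThetaVanishesAt A e he y := by
  intro F hF h0 α
  set φ := ContactElement.stdChart e he
  have hφ : ContinuousAt φ y := φ.continuousAt hy
  have : (𝓝[D] y).NeBot := mem_closure_iff_nhdsWithin_neBot.1 hyD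
  have hzero : ∀ᶠ z in 𝓝[D] y, thetaCoeff F (φ z) α = 0 := by
    have h1 : ∀ᶠ z in 𝓝[D] y, AnalyticAt ℂ F (φ z) :=
      (hφ.eventually hF.eventually_analyticAt).filter_mono nhdsWithin_le_nhds
    have h2 : ∀ᶠ z in 𝓝[D] y, ∀ᶠ z' in 𝓝[A] z, F (φ z') = 0 :=
      (eventually_eventually_nhdsWithin.2 h0).filter_mono (nhdsWithin_mono _ hDA)
    have h3 : ∀ᶠ z in 𝓝[D] y, z ∈ φ.source :=
      mem_nhdsWithin_of_mem_nhds (φ.open_source.mem_nhds hy)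
    filter_upwards [h1, h2, h3, self_mem_nhdsWithin] with z hz1 hz2 hz3 hz4
    exact hD z hz4 hz3 F hz1 hz2 α
  have hcont : ContinuousAt (fun z => thetaCoeff F (φ z) α) y := by
    simp only [thetaCoeff_eq_fderiv]
    have h1 : ContinuousAt (fun z => fderiv ℂ F (φ z)) y :=
      ContinuousAt.comp (g := fderiv ℂ F) hF.fderiv.continuousAt hφ
    have h2 : ContinuousAt (fun z => horizontalLift (φ z) α) y :=
      ContinuousAt.comp (g := fun q => horizontalLift q α)
        (contDiff_horizontalLift α).continuous.continuousAt hφ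
    exact h1.clm_apply h2
  exact tendsto_nhds_unique (hcont.mono_left nhdsWithin_le_nhds)
    (tendsto_const_nhds.congr' (hzero.mono fun z hz => hz.symm))

/-- At the points of `W_0`, the horizontal lifts are tangent to the web in coordinates where its
leaves are affine. -/
theorem LeavesAffineIn.thetaVanishesAt {W : Set (ContactElement N M)} (h : LeavesAffineIn W e)
    (he : e ∈ HolCoord M) {w : ContactElement N M} (hw : w ∈ W \ criticalSet W)
    (hwe : w ∈ (ContactElement.stdChart e he).source) : ThetaVanishesAt W e he w := by
  intro F hF h0 α
  set φ := ContactElement.stdChart e he with hφ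
  have hwb : w.base ∈ e.source := hwe.1
  obtain ⟨ℓ, c, O, hℓ, hO, hwO, hOe, hc, hleaf, hT⟩ := h w hw hwb
  have hker := planeIn_eq_ker he hℓ hwb hT
  have hp : graphPlane (φ w).2 = ContactElement.planeIn e w :=
    graphPlane_planeSlope (ContactElement.finrank_planeIn he hwb) hwe.2
  set v := (horizontalLift (φ w) α).1 with hv
  have hlv : ℓ v = 0 := by
    have : v ∈ LinearMap.ker (ℓ : Cn (N + 1) →ₗ[ℂ] ℂ) :=
      hker ▸ hp ▸ horizontalLift_fst_mem_graphPlane (φ w) α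
    exact this
  -- The complex line used as test curve: `x` moves in the direction `v` of the leaf and `p` stays
  -- fixed. It remains to see that it lies in `W` for small `t`.
  have hcurve : Continuous fun t : ℂ => (φ w) + t • horizontalLift (φ w) α := by fun_prop
  have hwt : φ w ∈ φ.target := φ.map_source hwe
  have htend : Tendsto (fun t : ℂ => φ.symm ((φ w) + t • horizontalLift (φ w) α)) (𝓝 0) (𝓝 w) := by
    have h1 : Tendsto φ.symm (𝓝 (φ w)) (𝓝 w) := by
      have := φ.continuousAt_symm hwt
      rwa [ContinuousAt, φ.left_inv hwe] at this
    refine h1.comp ?_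
    simpa using hcurve.tendsto 0
  have hφ1 : (φ w).1 = e w.base := rfl
  have htarget : ∀ᶠ t : ℂ in 𝓝 0, (φ w) + t • horizontalLift (φ w) α ∈ φ.target := by
    have : Tendsto (fun t : ℂ => (φ w) + t • horizontalLift (φ w) α) (𝓝 0) (𝓝 (φ w)) := by
      simpa using hcurve.tendsto 0
    exact this.eventually (φ.open_target.mem_nhds hwt)
  have hmemO : ∀ᶠ t : ℂ in 𝓝 0, e.symm (((φ w) + t • horizontalLift (φ w) α).1) ∈ O := by
    have h1 : ContinuousAt (fun t : ℂ => e.symm (((φ w) + t • horizontalLift (φ w) α).1)) 0 := by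
      refine ContinuousAt.comp (g := e.symm)
        (f := fun t : ℂ => ((φ w) + t • horizontalLift (φ w) α).1) ?_ (by fun_prop)
      refine e.continuousAt_symm ?_
      simpa [hφ1] using e.map_source hwb
    refine h1.eventually (hO.mem_nhds ?_)
    have : e.symm (((φ w) + (0 : ℂ) • horizontalLift (φ w) α).1) = w.base := by
      simpa [hφ1] using e.left_inv hwb
    exact mem_of_eq_of_mem this hwO
  have hW : ∀ᶠ t : ℂ in 𝓝 0, φ.symm ((φ w) + t • horizontalLift (φ w) α) ∈ W := by
    filter_upwards [htarget, hmemO] with t ht htO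
    set q := (φ w) + t • horizontalLift (φ w) α with hq
    have hqt : q.1 ∈ e.target := ht
    have hlq : ℓ (e (e.symm q.1)) = c := by
      rw [e.right_inv hqt, hq]
      have : ((φ w) + t • horizontalLift (φ w) α).1 = e w.base + t • v := rfl
      rw [this, map_add, map_smul, hlv, hc]
      simp
    -- The leaf provides an element `w'` of `W_0` over the displaced point. Its hyperplane is the
    -- kernel of the same `ℓ`, so its slopes are those of `w`, and `w'` is the point of the curve
    -- with parameter `t`.
    obtain ⟨-, w', hw', hbase, hT'⟩ := hleaf (e.symm q.1) ⟨htO, hlq⟩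
    have hb' : w'.base ∈ e.source := hbase ▸ e.map_target hqt
    have hker' := planeIn_eq_ker he hℓ hb' hT'
    have hplane : ContactElement.planeIn e w' = ContactElement.planeIn e w := hker'.trans hker.symm
    have hws : w' ∈ φ.source := ⟨hb', by rw [hplane]; exact hwe.2⟩
    have hφw' : φ w' = q := by
      refine Prod.ext ?_ ?_
      · refine Eq.trans ?_ (e.right_inv hqt)
        exact congrArg e hbase
      · have h1 : q.2 = (φ w).2 := by simp [hq, horizontalLift]
        rw [h1]
        exact congrArg planeSlope hplane
    rw [← hφw', φ.left_inv hws]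
    exact hw'.1
  have hzero : ∀ᶠ t : ℂ in 𝓝 0, F ((φ w) + t • horizontalLift (φ w) α) = 0 := by
    have h1 := (tendsto_nhdsWithin_iff.2 ⟨htend, hW⟩).eventually h0
    filter_upwards [h1, htarget] with t ht1 ht2
    rwa [φ.right_inv ht2] at ht1
  rw [thetaCoeff_eq_fderiv]
  -- `Θ_α` is the derivative at `t = 0` of `F` along the curve, where `F` is identically zero.
  have hline := hF.differentiableAt.hasFDerivAt.hasLineDerivAt (horizontalLift (φ w) α)
  exact hline.unique ((hasDerivAt_const (0 : ℂ) (0 : ℂ)).congr_of_eventuallyEq hzero)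

end Theta
-- The horizontal fields on the manifold of contact elements.
section LiftField

variable {N : ℕ} {M : Type*} [TopologicalSpace M] [ChartedSpace (Cn (N + 1)) M]
  [IsManifold 𝓘(ℂ, Cn (N + 1)) ω M]

/-- The vector field of `M̃` with coordinates `∂/∂x_α + p_α ∂/∂x_n`. -/
noncomputable def liftField (e : OpenPartialHomeomorph M (Cn (N + 1))) (he : e ∈ HolCoord M) (α : Fin N)
    (y : ContactElement N M) : TangentSpace 𝓘(ℂ, Cn (N + 1) × Cn N) y :=
  mfderiv 𝓘(ℂ, Cn (N + 1) × Cn N) 𝓘(ℂ, Cn (N + 1) × Cn N) (ContactElement.stdChart e he).symm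
    (ContactElement.stdChart e he y) (horizontalLift (ContactElement.stdChart e he y) α)

variable {e : OpenPartialHomeomorph M (Cn (N + 1))} (he : e ∈ HolCoord M)

theorem stdChart_mem_maximalAtlas :
    ContactElement.stdChart e he ∈
      IsManifold.maximalAtlas 𝓘(ℂ, Cn (N + 1) × Cn N) ω (ContactElement N M) :=
  IsManifold.subset_maximalAtlas (ContactElement.mem_atlas_iff.2 ⟨e, he, rfl⟩)

theorem mdifferentiableAt_stdChart_symm {y : ContactElement N M}
    (hy : y ∈ (ContactElement.stdChart e he).source) :
    MDifferentiableAt 𝓘(ℂ, Cn (N + 1) × Cn N) 𝓘(ℂ, Cn (N + 1) × Cn N)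
      (ContactElement.stdChart e he).symm (ContactElement.stdChart e he y) :=
  (contMDiffAt_symm_of_mem_maximalAtlas (stdChart_mem_maximalAtlas he)
    ((ContactElement.stdChart e he).map_source hy)).mdifferentiableAt (by simp)

/-- In the chart the field is `q ↦ horizontalLift q α`, which is polynomial; it is carried back to
the manifold by the tangent map of the inverse chart. -/
theorem contMDiffAt_liftField {x : ContactElement N M}
    (hx : x ∈ (ContactElement.stdChart e he).source) (α : Fin N) :
    ContMDiffAt 𝓘(ℂ, Cn (N + 1) × Cn N) 𝓘(ℂ, Cn (N + 1) × Cn N).tangent ω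
      (fun y => (⟨y, liftField e he α y⟩ :
        TangentBundle 𝓘(ℂ, Cn (N + 1) × Cn N) (ContactElement N M))) x := by
  set φ := ContactElement.stdChart e he with hφ
  have hsymm : ContMDiffOn 𝓘(ℂ, Cn (N + 1) × Cn N) 𝓘(ℂ, Cn (N + 1) × Cn N) ω φ.symm φ.target :=
    contMDiffOn_symm_of_mem_maximalAtlas (stdChart_mem_maximalAtlas he)
  have hT := hsymm.contMDiffOn_tangentMapWithin (m := ω) (by simp) φ.open_target.uniqueMDiffOn
  have hV : ContMDiffAt 𝓘(ℂ, Cn (N + 1) × Cn N) 𝓘(ℂ, Cn (N + 1) × Cn N).tangent ω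
      (fun q => (⟨q, horizontalLift q α⟩ :
        TangentBundle 𝓘(ℂ, Cn (N + 1) × Cn N) (Cn (N + 1) × Cn N))) (φ x) :=
    contMDiffAt_vectorSpace_iff_contDiffAt.2 (contDiff_horizontalLift α).contDiffAt
  have hc : ContMDiffAt 𝓘(ℂ, Cn (N + 1) × Cn N) 𝓘(ℂ, Cn (N + 1) × Cn N) ω φ x :=
    contMDiffAt_of_mem_maximalAtlas (stdChart_mem_maximalAtlas he) hx
  have hopen : IsOpen (Bundle.TotalSpace.proj ⁻¹' φ.target :
      Set (TangentBundle 𝓘(ℂ, Cn (N + 1) × Cn N) (Cn (N + 1) × Cn N))) :=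
    φ.open_target.preimage (FiberBundle.continuous_proj _ _)
  have hT' := hT.contMDiffAt (x := ⟨φ x, horizontalLift (φ x) α⟩)
    (hopen.mem_nhds (φ.map_source hx))
  refine (ContMDiffAt.comp x hT' (hV.comp x hc)).congr_of_eventuallyEq ?_
  filter_upwards [φ.open_source.mem_nhds hx] with y hy
  -- The tangent map yields a vector based at `φ.symm (φ y)`. All tangent spaces being the model
  -- space, it suffices to identify the base points.
  have hmk : ∀ (y' : ContactElement N M) (v : Cn (N + 1) × Cn N), y' = y →
      (⟨y, v⟩ : TangentBundle 𝓘(ℂ, Cn (N + 1) × Cn N) (ContactElement N M)) = ⟨y', v⟩ := by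
    rintro _ v rfl; rfl
  refine (hmk _ _ (φ.left_inv hy)).trans ?_
  exact (tangentMapWithin_eq_tangentMap (p := ⟨φ y, horizontalLift (φ y) α⟩)
    (φ.open_target.uniqueMDiffOn _ (φ.map_source hy))
    (mdifferentiableAt_stdChart_symm he hy)).symm

/-- The chain rule through the inverse chart, which links the intrinsic derivative to the
coefficients `Θ_α`. -/
theorem mfderiv_apply_liftField {f : ContactElement N M → ℂ} {y : ContactElement N M}
    (hy : y ∈ (ContactElement.stdChart e he).source)
    (hf : MDifferentiableAt 𝓘(ℂ, Cn (N + 1) × Cn N) 𝓘(ℂ, ℂ) f y) (α : Fin N) :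
    mfderiv 𝓘(ℂ, Cn (N + 1) × Cn N) 𝓘(ℂ, ℂ) f y (liftField e he α y) =
      thetaCoeff (f ∘ (ContactElement.stdChart e he).symm) (ContactElement.stdChart e he y) α := by
  set φ := ContactElement.stdChart e he with hφ
  have hyy : φ.symm (φ y) = y := φ.left_inv hy
  have hf' : MDifferentiableAt 𝓘(ℂ, Cn (N + 1) × Cn N) 𝓘(ℂ, ℂ) f (φ.symm (φ y)) := by rwa [hyy]
  have hcomp := DFunLike.congr_fun
    (mfderiv_comp (φ y) hf' (mdifferentiableAt_stdChart_symm he hy)) (horizontalLift (φ y) α)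
  have hT : ∀ (y' : ContactElement N M) (v : Cn (N + 1) × Cn N), y' = y →
      (mfderiv 𝓘(ℂ, Cn (N + 1) × Cn N) 𝓘(ℂ, ℂ) f y v : ℂ) =
        mfderiv 𝓘(ℂ, Cn (N + 1) × Cn N) 𝓘(ℂ, ℂ) f y' v := by
    rintro _ v rfl; rfl
  rw [thetaCoeff_eq_fderiv]
  refine (hT _ _ hyy).trans (hcomp.symm.trans ?_)
  exact DFunLike.congr_fun mfderiv_eq_fderiv _

/-- Tangency is tested on functions on the manifold; read in the chart, they become the functions
`F` to which the vanishing of `Θ_α` applies. -/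
theorem ThetaVanishesAt.liftField_mem_tangentAlong {A : Set (ContactElement N M)}
    {y : ContactElement N M} (h : ThetaVanishesAt A e he y)
    (hy : y ∈ (ContactElement.stdChart e he).source) (α : Fin N) :
    liftField e he α y ∈ tangentAlong (V := Cn (N + 1) × Cn N) A y := by
  intro f hf h0
  rw [mfderiv_apply_liftField he hy (hf.mdifferentiableAt (by simp))]
  set φ := ContactElement.stdChart e he with hφ
  have hyy : φ.symm (φ y) = y := φ.left_inv hy
  refine h _ ?_ ?_ α
  · have hf' : ContMDiffAt 𝓘(ℂ, Cn (N + 1) × Cn N) 𝓘(ℂ, ℂ) ω f (φ.symm (φ y)) := by rwa [hyy]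
    have h1 := ContMDiffAt.comp (φ y) hf' (contMDiffAt_symm_of_mem_maximalAtlas
      (stdChart_mem_maximalAtlas he) (φ.map_source hy))
    exact h1.contDiffAt.analyticAt
  · filter_upwards [h0, mem_nhdsWithin_of_mem_nhds (φ.open_source.mem_nhds hy)] with z hz hzs
    rwa [Function.comp_apply, φ.left_inv hzs]

/-- In the coordinates, `π` is `(x, p) ↦ x`, so `dπ` only forgets the `p`-component. -/
theorem projDeriv_liftField {y : ContactElement N M}
    (hy : y ∈ (ContactElement.stdChart e he).source) (α : Fin N) :
    (projDeriv y (liftField e he α y) : Cn (N + 1)) =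
      coordSymmDeriv e (e y.base) (horizontalLift (ContactElement.stdChart e he y) α).1 := by
  set φ := ContactElement.stdChart e he with hφ
  have hyy : φ.symm (φ y) = y := φ.left_inv hy
  have hφ1 : (φ y).1 = e y.base := rfl
  have hes : MDifferentiableAt 𝓘(ℂ, Cn (N + 1)) 𝓘(ℂ, Cn (N + 1)) e.symm (φ y).1 :=
    (ContactElement.mdifferentiable_holCoord he).mdifferentiableAt_symm (e.map_source hy.1)
  have hfst : MDifferentiableAt 𝓘(ℂ, Cn (N + 1) × Cn N) 𝓘(ℂ, Cn (N + 1))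
      (Prod.fst : Cn (N + 1) × Cn N → Cn (N + 1)) (φ y) :=
    differentiableAt_fst.mdifferentiableAt
  have hφd : MDifferentiableAt 𝓘(ℂ, Cn (N + 1) × Cn N) 𝓘(ℂ, Cn (N + 1) × Cn N) φ y :=
    (contMDiffAt_of_mem_maximalAtlas (stdChart_mem_maximalAtlas he) hy).mdifferentiableAt (by simp)
  have hbase : MDifferentiableAt 𝓘(ℂ, Cn (N + 1) × Cn N) 𝓘(ℂ, Cn (N + 1))
      (ContactElement.base : ContactElement N M → M) y := by
    refine (MDifferentiableAt.comp y (hes.comp (φ y) hfst) hφd).congr_of_eventuallyEq ?_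
    filter_upwards [φ.open_source.mem_nhds hy] with z hz
    exact (e.left_inv hz.1).symm
  have hbase' : MDifferentiableAt 𝓘(ℂ, Cn (N + 1) × Cn N) 𝓘(ℂ, Cn (N + 1))
      (ContactElement.base : ContactElement N M → M) (φ.symm (φ y)) := by rwa [hyy]
  have hcomp := DFunLike.congr_fun
    (mfderiv_comp (φ y) hbase' (mdifferentiableAt_stdChart_symm he hy)) (horizontalLift (φ y) α)
  -- This holds even outside the target of the chart, because both branches of `ofCoord` have base
  -- `e.symm q.1`; the derivatives can thus be compared directly.
  have hfun : (ContactElement.base : ContactElement N M → M) ∘ φ.symm =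
      e.symm ∘ (Prod.fst : Cn (N + 1) × Cn N → Cn (N + 1)) := by
    funext q
    exact ContactElement.base_ofCoord e q
  have hcomp' := DFunLike.congr_fun (mfderiv_comp (φ y) hes hfst) (horizontalLift (φ y) α)
  have hT : ∀ (y' : ContactElement N M) (v : Cn (N + 1) × Cn N), y' = y →
      (mfderiv 𝓘(ℂ, Cn (N + 1) × Cn N) 𝓘(ℂ, Cn (N + 1))
        (ContactElement.base : ContactElement N M → M) y v : Cn (N + 1)) =
        mfderiv 𝓘(ℂ, Cn (N + 1) × Cn N) 𝓘(ℂ, Cn (N + 1))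
        (ContactElement.base : ContactElement N M → M) y' v := by
    rintro _ v rfl; rfl
  have hG : ∀ g : Cn (N + 1) × Cn N → M, ContactElement.base ∘ φ.symm = g →
      (mfderiv 𝓘(ℂ, Cn (N + 1) × Cn N) 𝓘(ℂ, Cn (N + 1)) (ContactElement.base ∘ φ.symm) (φ y)
        (horizontalLift (φ y) α) : Cn (N + 1)) =
      mfderiv 𝓘(ℂ, Cn (N + 1) × Cn N) 𝓘(ℂ, Cn (N + 1)) g (φ y) (horizontalLift (φ y) α) := by
    rintro _ rfl; rfl
  refine (hT _ _ hyy).trans (hcomp.symm.trans ((hG _ hfun).trans (hcomp'.trans ?_)))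
  have h3 : mfderiv 𝓘(ℂ, Cn (N + 1) × Cn N) 𝓘(ℂ, Cn (N + 1))
      (Prod.fst : Cn (N + 1) × Cn N → Cn (N + 1)) (φ y) = ContinuousLinearMap.fst ℂ (Cn (N + 1)) (Cn N) :=
    mfderiv_eq_fderiv.trans fderiv_fst
  exact congrArg (fun v => coordSymmDeriv e (e y.base) v) (DFunLike.congr_fun h3 _)

/-- The first component of the horizontal lift lies in the hyperplane with slopes `p`, which is
`y.plane` read in the coordinates. -/
theorem contactForm_liftField {y : ContactElement N M}
    (hy : y ∈ (ContactElement.stdChart e he).source) (α : Fin N) :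
    contactForm y (liftField e he α y) = 0 := by
  have hp : graphPlane (ContactElement.stdChart e he y).2 = ContactElement.planeIn e y :=
    graphPlane_planeSlope (ContactElement.finrank_planeIn he hy.1) hy.2
  have hmem := horizontalLift_fst_mem_graphPlane (ContactElement.stdChart e he y) α
  rw [hp] at hmem
  obtain ⟨u, hu, huv⟩ := hmem
  have h1 : (projDeriv y (liftField e he α y) : Cn (N + 1)) = u := by
    rw [projDeriv_liftField he hy, ← huv]
    exact ContactElement.coordSymmDeriv_coordDeriv he hy.1 u
  refine (Submodule.Quotient.mk_eq_zero _).2 ?_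
  exact h1.symm ▸ hu

theorem linearIndependent_projDeriv_liftField {y : ContactElement N M}
    (hy : y ∈ (ContactElement.stdChart e he).source) :
    LinearIndependent ℂ fun α => projDeriv y (liftField e he α y) := by
  have h := (linearIndependent_horizontalLift_fst (ContactElement.stdChart e he y)).map'
    (coordSymmDeriv e (e y.base) : Cn (N + 1) →ₗ[ℂ] Cn (N + 1))
    (LinearMap.ker_eq_bot.2 (ContactElement.coordSymmDeriv_injective he (e.map_source hy.1)))
  have heq : (fun α => (projDeriv y (liftField e he α y) : Cn (N + 1))) =
      (coordSymmDeriv e (e y.base) : Cn (N + 1) →ₗ[ℂ] Cn (N + 1)) ∘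
        fun α => (horizontalLift (ContactElement.stdChart e he y) α).1 :=
    funext fun α => projDeriv_liftField he hy α
  exact heq.symm ▸ h

end LiftField

/-! ### Linear changes of affine coordinates. -/

section LinearChange

variable {N : ℕ} {M : Type*} [TopologicalSpace M] [ChartedSpace (Cn (N + 1)) M]

theorem exists_basisVec_notMem {Q : Submodule ℂ (Cn (N + 1))} (hQ : Module.finrank ℂ Q = N) :
    ∃ i, (basisVec i : Cn (N + 1)) ∉ Q := by
  by_contra! hall
  have htop : Q = ⊤ := by
    rw [eq_top_iff]
    intro v _
    have hdec : v = ∑ i, v i • basisVec i := by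
      ext j
      simp [basisVec, Pi.single_apply]
    rw [hdec]
    exact Submodule.sum_mem _ fun i _ => Submodule.smul_mem _ _ (hall i)
  rw [htop] at hQ
  simp at hQ

theorem coordDeriv_trans_linearEquiv {e : OpenPartialHomeomorph M (Cn (N + 1))}
    (he : e ∈ HolCoord M) (σ : Cn (N + 1) ≃L[ℂ] Cn (N + 1)) {m : M} (hm : m ∈ e.source)
    (v : TangentSpace 𝓘(ℂ, Cn (N + 1)) m) :
    coordDeriv (e.trans σ.toHomeomorph.toOpenPartialHomeomorph) m v = σ (coordDeriv e m v) := by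
  have h2 : MDifferentiableAt 𝓘(ℂ, Cn (N + 1)) 𝓘(ℂ, Cn (N + 1)) e m :=
    (ContactElement.mdifferentiable_holCoord he).mdifferentiableAt hm
  have h3 : MDifferentiableAt 𝓘(ℂ, Cn (N + 1)) 𝓘(ℂ, Cn (N + 1)) σ (e m) :=
    σ.differentiable.mdifferentiable _
  refine Eq.trans (DFunLike.congr_fun (mfderiv_comp m h3 h2) v) ?_
  have h5 : mfderiv 𝓘(ℂ, Cn (N + 1)) 𝓘(ℂ, Cn (N + 1)) σ (e m) =
      (σ : Cn (N + 1) →L[ℂ] Cn (N + 1)) :=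
    (mfderiv_eq_fderiv (f := σ) (x := e m)).trans σ.fderiv
  exact DFunLike.congr_fun h5 _

variable [IsManifold 𝓘(ℂ, Cn (N + 1)) ω M]

theorem trans_linearEquiv_mem_holCoord {e : OpenPartialHomeomorph M (Cn (N + 1))}
    (he : e ∈ HolCoord M) (σ : Cn (N + 1) ≃L[ℂ] Cn (N + 1)) :
    e.trans σ.toHomeomorph.toOpenPartialHomeomorph ∈ HolCoord M := by
  rw [IsManifold.mem_maximalAtlas_iff_contMDiffOn]
  constructor
  · have h2 : ContMDiff 𝓘(ℂ, Cn (N + 1)) 𝓘(ℂ, Cn (N + 1)) ω σ := σ.contDiff.contMDiff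
    simpa using h2.comp_contMDiffOn (contMDiffOn_of_mem_maximalAtlas he)
  · have h2 : ContMDiff 𝓘(ℂ, Cn (N + 1)) 𝓘(ℂ, Cn (N + 1)) ω σ.symm :=
      σ.symm.contDiff.contMDiff
    exact (contMDiffOn_symm_of_mem_maximalAtlas he).comp
      (h2.contMDiffOn (s := (e.trans σ.toHomeomorph.toOpenPartialHomeomorph).target))
      (by intro x hx; simpa using hx)

/-- Replacing `ℓ` by `ℓ ∘ σ⁻¹` leaves the hypersurface unchanged as a subset of `M`. -/
theorem LeavesAffineIn.trans_linearEquiv {W : Set (ContactElement N M)}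
    {e : OpenPartialHomeomorph M (Cn (N + 1))} (h : LeavesAffineIn W e)
    (σ : Cn (N + 1) ≃L[ℂ] Cn (N + 1)) :
    LeavesAffineIn W (e.trans σ.toHomeomorph.toOpenPartialHomeomorph) := by
  intro w hw hwe
  obtain ⟨ℓ, c, O, hℓ, hO, hwO, hOe, hc, hleaf, hT⟩ := h w hw (by simpa using hwe)
  have key : ∀ x, (ℓ.comp (σ.symm : Cn (N + 1) →L[ℂ] Cn (N + 1))) (σ x) = ℓ x := fun x => by simp
  have hset : {m | m ∈ O ∧ (ℓ.comp (σ.symm : Cn (N + 1) →L[ℂ] Cn (N + 1)))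
      ((e.trans σ.toHomeomorph.toOpenPartialHomeomorph) m) = c} = {m | m ∈ O ∧ ℓ (e m) = c} := by
    ext m
    exact and_congr_right fun _ => by
      rw [show (e.trans σ.toHomeomorph.toOpenPartialHomeomorph) m = σ (e m) from rfl, key]
  refine ⟨ℓ.comp (σ.symm : Cn (N + 1) →L[ℂ] Cn (N + 1)), c, O, ?_, hO, hwO, by simpa using hOe,
    (key _).trans hc, ?_, ?_⟩
  · intro h0
    apply hℓ
    ext x
    rw [← key x, h0]
    rfl
  · rw [hset]; exact hleaf
  · rw [hset]; exact hT

/-- Affine coordinates for the leaves can be chosen so that a given contact element belongs to the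
domain of the coordinates `(x, p)`. -/
theorem LeavesAffineIn.exists_stdChart {W : Set (ContactElement N M)}
    {e : OpenPartialHomeomorph M (Cn (N + 1))} (h : LeavesAffineIn W e) (he : e ∈ HolCoord M)
    {w : ContactElement N M} (hw : w.base ∈ e.source) :
    ∃ (e' : OpenPartialHomeomorph M (Cn (N + 1))) (he' : e' ∈ HolCoord M),
      LeavesAffineIn W e' ∧ w ∈ (ContactElement.stdChart e' he').source := by
  obtain ⟨i, hi⟩ := exists_basisVec_notMem (ContactElement.finrank_planeIn he hw)
  -- Exchanging a coordinate whose basis vector is not in the hyperplane with the last one puts the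
  -- contact element in the domain of the new `(x, p)`.
  let σ : Cn (N + 1) ≃L[ℂ] Cn (N + 1) :=
    (LinearIsometryEquiv.piLpCongrLeft 2 ℂ ℂ (Equiv.swap i (Fin.last N))).toContinuousLinearEquiv
  have hσ : σ (basisVec i) = basisVec (Fin.last N) := by
    simp [σ, basisVec]
  refine ⟨_, trans_linearEquiv_mem_holCoord he σ, h.trans_linearEquiv σ, by simpa using! hw, ?_⟩
  rintro ⟨v, hv, hv'⟩
  refine hi ⟨v, hv, σ.injective ?_⟩
  rw [hσ]
  exact (coordDeriv_trans_linearEquiv he σ hw v).symm.trans hv'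

end LinearChange

/-! ### Extension of the tautological lift, and dicriticality. -/

section Main

variable {N : ℕ} {M : Type*} [TopologicalSpace M] [ChartedSpace (Cn (N + 1)) M]
  [IsManifold 𝓘(ℂ, Cn (N + 1)) ω M] {W C : Set (ContactElement N M)}

/-- A smaller set has more vanishing functions, so the property does not pass to subsets in general;
it depends only on the germ of the set. -/
theorem ThetaVanishesAt.of_eventually_nhdsWithin {e : OpenPartialHomeomorph M (Cn (N + 1))}
    {he : e ∈ HolCoord M} {y : ContactElement N M} (h : ThetaVanishesAt W e he y)
    (hCW : 𝓝[C] y = 𝓝[W] y) : ThetaVanishesAt C e he y :=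
  fun F hF h0 => h F hF (hCW ▸ h0)

theorem LeavesAffineIn.thetaVanishes {e : OpenPartialHomeomorph M (Cn (N + 1))}
    (h : LeavesAffineIn W e) (he : e ∈ HolCoord M)
    (hpure : HasPureDim (V := Cn (N + 1) × Cn N) W (N + 1))
    (hdim : HasDimLE (V := Cn (N + 1) × Cn N) (criticalSet W) N) : ThetaVanishes W e he :=
  fun _ hw hwe => ThetaVanishesAt.of_mem_closure sdiff_subset
    (subset_closure_diff_criticalSet hpure hdim hw) hwe fun _ hz hze => h.thetaVanishesAt he hz hze

/-- The frame consists of the fields `liftField` of an affine chart around `x`. Their tangency to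
`C` comes by closure from the points of `W_0` where `C` and `W` have the same germ. -/
theorem IsTotallyLinearizable.tautologicalLiftExtends (hlin : IsTotallyLinearizable W)
    (hclosed : IsClosed W) (hdim : HasDimLE (V := Cn (N + 1) × Cn N) (criticalSet W) N)
    (hC : IsWebComponent W C) : TautologicalLiftExtends C := by
  intro x _
  obtain ⟨e₀, he₀, hx₀, haff₀⟩ := hlin x.base
  obtain ⟨e, he, haff, hx⟩ := haff₀.exists_stdChart he₀ hx₀
  refine ⟨liftField e he, fun α => ⟨contMDiffAt_liftField he hx α, ?_⟩,
    linearIndependent_projDeriv_liftField he hx⟩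
  filter_upwards [mem_nhdsWithin_of_mem_nhds
    ((ContactElement.stdChart e he).open_source.mem_nhds hx), self_mem_nhdsWithin] with y hy hyC
  refine ⟨ThetaVanishesAt.liftField_mem_tangentAlong he ?_ hy α, contactForm_liftField he hy α⟩
  exact ThetaVanishesAt.of_mem_closure (fun z hz => hz.1)
    (hC.subset_closure_eq_nhdsWithin hclosed hdim hyC) hy fun z hz hze =>
      (haff.thetaVanishesAt he hz.2.1 hze).of_eventually_nhdsWithin hz.2.2

/-- Vectors with linearly independent images under the linear map `dπ` are linearly independent. -/
theorem TautologicalLiftExtends.isDicriticalOn (h : TautologicalLiftExtends C) :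
    IsDicriticalOn C := by
  intro x hx
  obtain ⟨ξ, hξ, hli⟩ := h x hx
  exact ⟨ξ, hξ, LinearIndependent.of_comp
    (projDeriv x : TangentSpace 𝓘(ℂ, Cn (N + 1) × Cn N) x →ₗ[ℂ]
      TangentSpace 𝓘(ℂ, Cn (N + 1)) x.base) hli⟩

end Main

/-- The last clause covers every holomorphic `F` vanishing on `W`, so the vanishing of the matrix
`Θ` of a system of local equations is the case where `F` is one of them. -/
theorem proposition5p8 {N : ℕ} {M : Type*} [TopologicalSpace M] [T2Space M]
    [ChartedSpace (Cn (N + 1)) M] [IsManifold 𝓘(ℂ, Cn (N + 1)) ω M]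
    (d : ℕ) (W : Set (ContactElement N M)) (hW : IsWeb d W) (hlin : IsTotallyLinearizable W) :
    IsDicritical W ∧
    (∀ C, IsWebComponent W C → TautologicalLiftExtends C) ∧
    (∀ (e : OpenPartialHomeomorph M (Cn (N + 1))) (he : e ∈ HolCoord M),
      LeavesAffineIn W e → ThetaVanishes W e he) := by
  have hlift : ∀ C, IsWebComponent W C → TautologicalLiftExtends C := fun C hC =>
    hlin.tautologicalLiftExtends hW.analytic.1 hW.critical_dim hC
  exact ⟨fun C hC => (hlift C hC).isDicriticalOn, hlift,
    fun e he h => h.thetaVanishes he hW.pureDim hW.critical_dim⟩
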